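/- Consider $N$ agents $\dot x_i = A x_i + B u_i$, $y_i = C x_i$ ($i=1,\dots,N$), with $x_i(t)\in\mathbf R^n$, $u_i(t)\in\mathbf R^p$, $y_i(t)\in\mathbf R^q$, where $(A,B)$ is stabilizable and $(A,C)$ is detectable. The agents communicate over an undirected connected graph $\mathcal G$ with $0/1$ adjacency matrix $[a_{ij}]$, $a_{ii}=0$. Let $P>0$ be symmetric with $PA+A^TP-PBB^TP+I=0$, and put $K=-B^TP$, $\Gamma=PBB^TP$. Let $\kappa_{ij}=\kappa_{ji}>0$ for every edge, and let $\delta,\mu,\nu>0$. Agent $i$ has event instants $0=t_0^i<t_1^i<\cdots$. Put $\tilde x_i(t)=e^{A(t-t_k^i)}x_i(t_k^i)$ for $t\in[t_k^i,t_{k+1}^i)$, and $e_i=\tilde x_i-x_i$. The event-triggered adaptive protocol without $\sigma$-modification (i.e. with $\varrho_{ij}=0$ for every edge in the general adaptive law $\dot c_{ij}=\kappa_{ij}a_{ij}[-\varrho_{ij}c_{ij}+(\tilde x_i-\tilde x_j)^T\Gamma(\tilde x_i-\tilde x_j)]$) is $$u_i=K\sum_{j=1}^N c_{ij}a_{ij}(\tilde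 x_i-\tilde x_j),\qquad \dot c_{ij}=\kappa_{ij}a_{ij}(\tilde x_i-\tilde x_j)^T\Gamma(\tilde x_i-\tilde x_j),$$ with initial weights $c_{ij}(0)=c_{ji}(0)\ge 0$ for every edge and arbitrary initial states. The event instants are $t_{k+1}^i=\inf\{t>t_k^i : f_i(t)\ge 0\}$ ($=\infty$ if the set is empty), where $$f_i(t)=\sum_{j=1}^N(1+\delta c_{ij})a_{ij}e_i^T\Gamma e_i-\frac14\sum_{j=1}^N a_{ij}(\tilde x_i-\tilde x_j)^T\Gamma(\tilde x_i-\tilde x_j)-\mu e^{-\nu t}$$ is evaluated with the value of $\tilde x_i$ before its reset; if several agents have an event at the same time, these events may be processed in any order. Consider any evolution of this closed-loop network, defined up to the first accumulation time $T\in(0,\infty]$ of the event instants of an agent ($T=\infty$ if there is none). Then $T=\infty$, i.e. the evolution is defined for all $t\ge0$, and the consensus error $\xi=[\xi_1^T,\dots,\xi_N^T]^T$, $\xi_i=x_i-\frac1N\sum_{j=1}^N x_j$, converges to zero: $\lim_{t\to\infty}\xi(t)=0$. -/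

import Mathlib

open Matrix

namespace EventConsensus

noncomputable section

/-- A real square matrix is Hurwitz: all its complex eigenvalues have negative real part. -/
def IsHurwitz {n : ℕ} (A : Matrix (Fin n) (Fin n) ℝ) : Prop :=
  ∀ z ∈ spectrum ℂ (A.map (algebraMap ℝ ℂ)), z.re < 0

/-- `(A, B)` is stabilizable. -/
def Stabilizable {n p : ℕ} (A : Matrix (Fin n) (Fin n) ℝ) (B : Matrix (Fin n) (Fin p) ℝ) : Prop :=
  ∃ F : Matrix (Fin p) (Fin n) ℝ, IsHurwitz (A + B * F)

/-- `(A, C)` is detectable. -/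
def Detectable {n q : ℕ} (A : Matrix (Fin n) (Fin n) ℝ) (C : Matrix (Fin q) (Fin n) ℝ) : Prop :=
  ∃ F : Matrix (Fin n) (Fin q) ℝ, IsHurwitz (A + F * C)

/-- The quadratic form `vᵀ Γ v`. -/
def quadForm {n : ℕ} (Γ : Matrix (Fin n) (Fin n) ℝ) (v : Fin n → ℝ) : ℝ :=
  v ⬝ᵥ (Γ *ᵥ v)

/-- The control input `u_i = K ∑_j c_ij a_ij (x̃_i - x̃_j)` computed from estimates `xt = x̃` and
coupling weights `c`. -/
def controlInput {N n p : ℕ} (G : SimpleGraph (Fin N)) [DecidableRel G.Adj]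
    (K : Matrix (Fin p) (Fin n) ℝ) (c : Fin N → Fin N → ℝ) (xt : Fin N → Fin n → ℝ)
    (i : Fin N) : Fin p → ℝ :=
  K *ᵥ ∑ j, (c i j * G.adjMatrix ℝ i j) • (xt i - xt j)

/-- The right-hand side `κ_ij a_ij [-ϱ_ij c_ij + (x̃_i - x̃_j)ᵀ Γ (x̃_i - x̃_j)]` of the adaptive law
of the coupling weights. -/
def adaptiveLaw {N n : ℕ} (G : SimpleGraph (Fin N)) [DecidableRel G.Adj]
    (Γ : Matrix (Fin n) (Fin n) ℝ) (κ ϱ : Fin N → Fin N → ℝ) (c : Fin N → Fin N → ℝ)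
    (xt : Fin N → Fin n → ℝ) (i j : Fin N) : ℝ :=
  κ i j * G.adjMatrix ℝ i j * (-(ϱ i j) * c i j + quadForm Γ (xt i - xt j))

/-- The triggering function of agent `i` at time `t`,
`∑_j (1 + δ c_ij) a_ij e_iᵀ Γ e_i - (1/4) ∑_j a_ij (x̃_i - x̃_j)ᵀ Γ (x̃_i - x̃_j) - μ exp(-ν t)`,
with `e_i = x̃_i - x_i`, where `xi = x_i` is the state of agent `i`, `zi = x̃_i` its estimate, and
`z j = x̃_j` are the estimates of the other agents. -/
def triggerFn {N n : ℕ} (G : SimpleGraph (Fin N)) [DecidableRel G.Adj]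
    (Γ : Matrix (Fin n) (Fin n) ℝ) (δ μ ν : ℝ) (c : Fin N → Fin N → ℝ) (i : Fin N)
    (xi zi : Fin n → ℝ) (z : Fin N → Fin n → ℝ) (t : ℝ) : ℝ :=
  ∑ j, (1 + δ * c i j) * G.adjMatrix ℝ i j * quadForm Γ (zi - xi)
    - 1 / 4 * ∑ j, G.adjMatrix ℝ i j * quadForm Γ (zi - z j)
    - μ * Real.exp (-ν * t)

/-- The estimate `e^{A (t - t_k^i)} x_i(t_k^i)` of the state of agent `i` at time `t` that is based
on its `k`-th event instant `t_k^i = τ i k`. -/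
def estimate {N n : ℕ} (A : Matrix (Fin n) (Fin n) ℝ) (τ : Fin N → ℕ → EReal)
    (x : ℝ → Fin N → Fin n → ℝ) (i : Fin N) (k : ℕ) (t : ℝ) : Fin n → ℝ :=
  NormedSpace.exp ((t - (τ i k).toReal) • A) *ᵥ x (τ i k).toReal i

/-- The end of the time interval on which the event instants determine the evolution: the earliest
accumulation time of the event instants of an agent, and `⊤` if there is none. An agent with only
finitely many events has `τ i k = ⊤` for all large `k`. Thus `horizon τ = ⊤` says that there
is no Zeno behavior. -/
def horizon {N : ℕ} (τ : Fin N → ℕ → EReal) : EReal :=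
  ⨅ i, ⨆ k, τ i k

/-- `v` is a value of the estimate of agent `j` that its neighbours may use at time `t`: the current
estimate `x̃_j(t)` or, if `t` is itself an event instant of agent `j`, possibly still the value just
before the broadcast. -/
def IsAvailable {N n : ℕ} (A : Matrix (Fin n) (Fin n) ℝ) (τ : Fin N → ℕ → EReal)
    (x xt : ℝ → Fin N → Fin n → ℝ) (j : Fin N) (t : ℝ) (v : Fin n → ℝ) : Prop :=
  v = xt t j ∨ ∃ m : ℕ, τ j (m + 1) = (t : EReal) ∧ v = estimate A τ x j m t

/-- The states `x`, estimates `xt = x̃`, coupling weights `c` and event instants `τ i k = t_k^i` form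
an evolution of the closed-loop event-triggered adaptive network, up to the horizon. The evolution
is not assumed to be free of Zeno behavior. Controls jump at event instants, hence states and weights
are continuous and have the prescribed derivative from the right at every time. -/
structure IsClosedLoop {N n p : ℕ} (G : SimpleGraph (Fin N)) [DecidableRel G.Adj]
    (A : Matrix (Fin n) (Fin n) ℝ) (B : Matrix (Fin n) (Fin p) ℝ)
    (K : Matrix (Fin p) (Fin n) ℝ) (Γ : Matrix (Fin n) (Fin n) ℝ)
    (κ ϱ : Fin N → Fin N → ℝ) (δ μ ν : ℝ)
    (x xt : ℝ → Fin N → Fin n → ℝ) (c : ℝ → Fin N → Fin N → ℝ)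
    (τ : Fin N → ℕ → EReal) : Prop where
  /-- The initial time is an event instant of every agent. -/
  event_zero : ∀ i, τ i 0 = 0
  /-- `t_{k+1}^i = inf {t > t_k^i | f_i(t) ≥ 0}`, which is `⊤` for an empty set; `f_i` is computed
  with the estimate of agent `i` before its reset. If neighbours have an event at exactly the same
  time, every order of processing the simultaneous events is allowed (the function `z`). -/
  event_succ : ∀ i k, ∃ z : ℝ → Fin N → Fin n → ℝ,
    (∀ t j, IsAvailable A τ x xt j t (z t j)) ∧
    τ i (k + 1) = sInf ((fun t : ℝ => (t : EReal)) '' {t : ℝ | τ i k < (t : EReal) ∧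
      (t : EReal) < horizon τ ∧
      0 ≤ triggerFn G Γ δ μ ν (c t) i (x t i) (estimate A τ x i k t) (z t) t})
  /-- `x̃_i(t) = e^{A (t - t_k^i)} x_i(t_k^i)` for `t ∈ [t_k^i, t_{k+1}^i)`. -/
  estimate_eq : ∀ i k (t : ℝ), τ i k ≤ (t : EReal) → (t : EReal) < τ i (k + 1) →
    xt t i = estimate A τ x i k t
  state_continuous : ContinuousOn x {t : ℝ | 0 ≤ t ∧ (t : EReal) < horizon τ}
  weight_continuous : ContinuousOn c {t : ℝ | 0 ≤ t ∧ (t : EReal) < horizon τ}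
  /-- `ẋ_i = A x_i + B u_i`. -/
  state_deriv : ∀ t : ℝ, 0 ≤ t → (t : EReal) < horizon τ → ∀ i,
    HasDerivWithinAt (fun s => x s i)
      (A *ᵥ x t i + B *ᵥ controlInput G K (c t) (xt t) i) (Set.Ici t) t
  /-- The adaptive law of the coupling weights. -/
  weight_deriv : ∀ t : ℝ, 0 ≤ t → (t : EReal) < horizon τ → ∀ i j,
    HasDerivWithinAt (fun s => c s i j)
      (adaptiveLaw G Γ κ ϱ (c t) (xt t) i j) (Set.Ici t) t

/-- The consensus error `ξ_i = x_i - (1/N) ∑_j x_j`. -/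
def consensusError {N n : ℕ} (x : ℝ → Fin N → Fin n → ℝ) (t : ℝ) : Fin N → Fin n → ℝ :=
  fun i => x t i - (1 / (N : ℝ)) • ∑ j, x t j

end

end EventConsensus

/-!
Write `H = Bᵀ P`, `Γ = Hᵀ H`, `eᵢ = x̃ᵢ - xᵢ` and `qᵢⱼ = (x̃ᵢ - x̃ⱼ)ᵀ Γ (x̃ᵢ - x̃ⱼ)`. The weights of the
edges stay symmetric and are nondecreasing, because `ċᵢⱼ = κᵢⱼ qᵢⱼ` is symmetric and nonnegative. The
proof rests on the Lyapunov function
`∑ ξᵢᵀ P ξᵢ + (1/4) ∑ aᵢⱼ (cᵢⱼ - α)² / κᵢⱼ + β e^{-νt}`. By the Riccati equation its rate is at most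
`-∑ |ξᵢ|²` (`IsClosedLoop.lyapunov_decay`): the coupling contributes `-(1/2) ∑ cᵢⱼ aᵢⱼ qᵢⱼ` up to
errors `eᵢ` (`coupling_le`), which the triggering rule bounds by `∑ aᵢⱼ qᵢⱼ` and the threshold; the
adaptive law turns `∑ cᵢⱼ aᵢⱼ qᵢⱼ` into `α ∑ aᵢⱼ qᵢⱼ`; and for large `α` this dominates `∑ |H ξᵢ|²`
by a Poincaré inequality on the connected graph (`exists_poincare`). The triggering inequality is
needed at all times, including those at which a neighbour broadcasts; there it follows by a limit
from the right (`IsClosedLoop.triggerFn_nonpos`).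

In particular the weights are bounded, so `∫ qᵢⱼ` is finite for every edge. This excludes an
accumulation of events (`IsClosedLoop.horizon_eq_top`), even though no pointwise bound of the inputs
is available: the transported state `e^{-tA} xᵢ(t)` moves only under the input, whose integral is
controlled by the growth of the weights, so before an accumulation time it oscillates arbitrarily
little, whereas an event requires `|eᵢ|` to exceed a fixed threshold.

On `[0, ∞)` the Lyapunov function and the weights are monotone and bounded, so `∑ ξᵢᵀ P ξᵢ` has a
limit; a positive limit is incompatible with the rate of decay (`tendsto_consensusError`).
-/

namespace EventConsensus

open Filter Topology

/-! ### Quadratic forms -/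

/-- `Γ = Hᵀ H` with `H = Bᵀ P`. -/
theorem quadForm_eq_normSq {n p : ℕ} (P : Matrix (Fin n) (Fin n) ℝ) (hP : P.IsHermitian)
    (B : Matrix (Fin n) (Fin p) ℝ) (v : Fin n → ℝ) :
    quadForm (P * B * Bᵀ * P) v = ((Bᵀ * P) *ᵥ v) ⬝ᵥ ((Bᵀ * P) *ᵥ v) := by
  have hPt : Pᵀ = P := by simpa [Matrix.IsHermitian] using hP
  have h : P * B * Bᵀ * P = (Bᵀ * P)ᵀ * (Bᵀ * P) := by
    rw [Matrix.transpose_mul, Matrix.transpose_transpose, hPt]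
    simp only [Matrix.mul_assoc]
  rw [quadForm, h, ← Matrix.mulVec_mulVec, Matrix.dotProduct_mulVec, Matrix.vecMul_transpose]

theorem zero_le_dotProduct_self {m : ℕ} (v : Fin m → ℝ) : 0 ≤ v ⬝ᵥ v :=
  Finset.sum_nonneg fun i _ => mul_self_nonneg (v i)

theorem sq_apply_le_dotProduct_self {m : ℕ} (v : Fin m → ℝ) (i : Fin m) : v i ^ 2 ≤ v ⬝ᵥ v := by
  rw [pow_two]
  exact Finset.single_le_sum (f := fun i => v i * v i) (fun i _ => mul_self_nonneg (v i))
    (Finset.mem_univ i)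

theorem dotProduct_self_le_norm {m : ℕ} (v : Fin m → ℝ) : v ⬝ᵥ v ≤ m * ‖v‖ ^ 2 := by
  calc v ⬝ᵥ v = ∑ i, v i * v i := rfl
    _ ≤ ∑ _i : Fin m, ‖v‖ ^ 2 := by
        refine Finset.sum_le_sum fun i _ => ?_
        have h := norm_le_pi_norm v i
        rw [Real.norm_eq_abs] at h
        rw [← abs_mul_abs_self, pow_two]
        exact mul_self_le_mul_self (abs_nonneg _) h
    _ = m * ‖v‖ ^ 2 := by simp

theorem norm_le_one_add_dotProduct_self {m : ℕ} (v : Fin m → ℝ) : ‖v‖ ≤ 1 + v ⬝ᵥ v := by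
  refine (pi_norm_le_iff_of_nonneg (by linarith [zero_le_dotProduct_self v])).2 fun i => ?_
  have h := sq_apply_le_dotProduct_self v i
  rw [Real.norm_eq_abs, abs_le]
  constructor <;> nlinarith [sq_nonneg (v i - 1), sq_nonneg (v i + 1)]

theorem quadForm_le {m : ℕ} (P : Matrix (Fin m) (Fin m) ℝ) :
    ∃ C : ℝ, 0 < C ∧ ∀ v, quadForm P v ≤ C * (v ⬝ᵥ v) := by
  refine ⟨1 + ∑ i, ∑ j, |P i j|, ?_, fun v => ?_⟩
  · have : 0 ≤ ∑ i, ∑ j, |P i j| :=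
      Finset.sum_nonneg fun i _ => Finset.sum_nonneg fun j _ => abs_nonneg _
    linarith
  · have h : quadForm P v ≤ (∑ i, ∑ j, |P i j|) * (v ⬝ᵥ v) := by
      have e : quadForm P v = ∑ i, ∑ j, v i * (P i j * v j) := by
        simp only [quadForm, Matrix.mulVec, dotProduct, Finset.mul_sum]
      rw [e, Finset.sum_mul]
      refine Finset.sum_le_sum fun i _ => ?_
      rw [Finset.sum_mul]
      refine Finset.sum_le_sum fun j _ => ?_
      have hi := sq_apply_le_dotProduct_self v i
      have hj := sq_apply_le_dotProduct_self v j
      have h1 : v i * v j * P i j ≤ |v i * v j| * |P i j| := by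
        rw [← abs_mul]; exact le_abs_self _
      have h2 : |v i * v j| ≤ v ⬝ᵥ v := by
        rw [abs_le]
        constructor <;> nlinarith [sq_nonneg (v i - v j), sq_nonneg (v i + v j)]
      have h3 := mul_le_mul_of_nonneg_right h2 (abs_nonneg (P i j))
      nlinarith
    have := zero_le_dotProduct_self v
    nlinarith

/-- Coercivity, by compactness of the unit sphere. -/
theorem PosDef.exists_le_quadForm {m : ℕ} {P : Matrix (Fin m) (Fin m) ℝ} (hP : P.PosDef) :
    ∃ k : ℝ, 0 < k ∧ ∀ v, k * ‖v‖ ^ 2 ≤ quadForm P v := by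
  have hcont : Continuous (quadForm P) := by
    unfold quadForm; fun_prop
  have hpos : ∀ v : Fin m → ℝ, v ≠ 0 → 0 < quadForm P v := fun v hv => by
    simpa [quadForm] using hP.dotProduct_mulVec_pos hv
  rcases (Metric.sphere (0 : Fin m → ℝ) 1).eq_empty_or_nonempty with he | hne
  · refine ⟨1, one_pos, fun v => ?_⟩
    have hv : v = 0 := by
      by_contra hv
      have : ‖v‖⁻¹ • v ∈ Metric.sphere (0 : Fin m → ℝ) 1 := by
        simp [norm_smul, norm_ne_zero_iff.2 hv]
      rw [he] at this
      exact this
    simp [hv, quadForm]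
  · obtain ⟨u, hu, hmin⟩ := (isCompact_sphere (0 : Fin m → ℝ) 1).exists_isMinOn hne
      hcont.continuousOn
    have hu1 : ‖u‖ = 1 := by simpa using hu
    refine ⟨quadForm P u, hpos u (by rintro rfl; simp at hu1), fun v => ?_⟩
    by_cases hv : v = 0
    · simp [hv, quadForm]
    have hn : ‖v‖ ≠ 0 := norm_ne_zero_iff.2 hv
    have h : quadForm P u ≤ quadForm P (‖v‖⁻¹ • v) :=
      hmin (show ‖v‖⁻¹ • v ∈ Metric.sphere (0 : Fin m → ℝ) 1 by simp [norm_smul, hn])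
    have h2 : quadForm P (‖v‖⁻¹ • v) = (‖v‖ ^ 2)⁻¹ * quadForm P v := by
      simp only [quadForm, Matrix.mulVec_smul, dotProduct_smul, smul_dotProduct, smul_eq_mul]
      ring
    rw [h2] at h
    have hn2 : 0 < ‖v‖ ^ 2 := by positivity
    calc quadForm P u * ‖v‖ ^ 2 ≤ (‖v‖ ^ 2)⁻¹ * quadForm P v * ‖v‖ ^ 2 := by gcongr
      _ = quadForm P v := by field_simp

/-! ### Weighted sums over pairs of agents -/

theorem sum_sum_swap {N : ℕ} {w : Fin N → Fin N → ℝ} (hw : ∀ i j, w i j = w j i)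
    (f : Fin N → Fin N → ℝ) : ∑ i, ∑ j, w i j * f i j = ∑ i, ∑ j, w i j * f j i := by
  rw [Finset.sum_comm]
  exact Finset.sum_congr rfl fun i _ => Finset.sum_congr rfl fun j _ => by rw [hw]

/-- The exchanges between pairs of agents cancel. -/
theorem sum_sum_smul_sub_eq_zero {N m : ℕ} {w : Fin N → Fin N → ℝ} (hw : ∀ i j, w i j = w j i)
    (z : Fin N → Fin m → ℝ) : ∑ i, ∑ j, w i j • (z i - z j) = 0 := by
  ext r
  simp only [Finset.sum_apply, Pi.smul_apply, Pi.sub_apply, smul_eq_mul, Pi.zero_apply, mul_sub,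
    Finset.sum_sub_distrib]
  rw [sum_sum_swap hw (fun i _ => z i r), sub_self]

theorem two_mul_sum_dotProduct_sum {N m : ℕ} {w : Fin N → Fin N → ℝ} (hw : ∀ i j, w i j = w j i)
    (y z : Fin N → Fin m → ℝ) :
    2 * ∑ i, y i ⬝ᵥ ∑ j, w i j • (z i - z j)
      = ∑ i, ∑ j, w i j * ((y i - y j) ⬝ᵥ (z i - z j)) := by
  have h1 : ∀ i, y i ⬝ᵥ ∑ j, w i j • (z i - z j) = ∑ j, w i j * (y i ⬝ᵥ (z i - z j)) := by
    intro i
    rw [dotProduct_sum]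
    simp only [dotProduct_smul, smul_eq_mul]
  have h2 := sum_sum_swap hw (fun i j => y i ⬝ᵥ (z i - z j))
  have h3 : ∀ i j, (y i - y j) ⬝ᵥ (z i - z j) = y i ⬝ᵥ (z i - z j) + y j ⬝ᵥ (z j - z i) := by
    intro i j
    rw [sub_dotProduct, ← neg_sub (z j) (z i), dotProduct_neg, dotProduct_neg]
    ring
  simp only [h1, h3, mul_add, Finset.sum_add_distrib]
  rw [← h2]
  ring

/-- Effect of the coupling on the disagreement of the agents when the neighbours use the estimates
`z` instead of the states `y`: the estimated disagreement is damped, up to the errors `z - y`. -/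
theorem coupling_le {N m : ℕ} {w : Fin N → Fin N → ℝ} (hw : ∀ i j, w i j = w j i)
    (hw0 : ∀ i j, 0 ≤ w i j) (y z : Fin N → Fin m → ℝ) :
    -(2 * ∑ i, y i ⬝ᵥ ∑ j, w i j • (z i - z j))
      ≤ -(1 / 2) * ∑ i, ∑ j, w i j * ((z i - z j) ⬝ᵥ (z i - z j))
        + 2 * ∑ i, ∑ j, w i j * ((z i - y i) ⬝ᵥ (z i - y i)) := by
  rw [two_mul_sum_dotProduct_sum hw]
  have hs := sum_sum_swap hw (fun i _ => (z i - y i) ⬝ᵥ (z i - y i))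
  have key : ∀ i j, -((y i - y j) ⬝ᵥ (z i - z j)) ≤ -(1 / 2) * ((z i - z j) ⬝ᵥ (z i - z j))
      + ((z i - y i) ⬝ᵥ (z i - y i)) + ((z j - y j) ⬝ᵥ (z j - y j)) := by
    intro i j
    simp only [dotProduct, Finset.mul_sum, ← Finset.sum_add_distrib, ← Finset.sum_neg_distrib]
    refine Finset.sum_le_sum fun r _ => ?_
    simp only [Pi.sub_apply]
    nlinarith [sq_nonneg ((z i r - y i r) + (z j r - y j r)),
      sq_nonneg ((z i r - z j r) - ((z i r - y i r) - (z j r - y j r)))]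
  have h : ∑ i, ∑ j, w i j * -((y i - y j) ⬝ᵥ (z i - z j)) ≤
      ∑ i, ∑ j, w i j * (-(1 / 2) * ((z i - z j) ⬝ᵥ (z i - z j))
      + ((z i - y i) ⬝ᵥ (z i - y i)) + ((z j - y j) ⬝ᵥ (z j - y j))) :=
    Finset.sum_le_sum fun i _ => Finset.sum_le_sum fun j _ =>
      mul_le_mul_of_nonneg_left (key i j) (hw0 i j)
  simp only [mul_add, Finset.sum_add_distrib, mul_neg, Finset.sum_neg_distrib] at h
  simp only [mul_left_comm _ (-(1 / 2) : ℝ), ← Finset.mul_sum] at h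
  linarith

/-- The disagreement of the states is controlled by that of the estimates `z` and the errors. -/
theorem sum_disagreement_le {N m : ℕ} {w : Fin N → Fin N → ℝ} (hw : ∀ i j, w i j = w j i)
    (hw0 : ∀ i j, 0 ≤ w i j) (y z : Fin N → Fin m → ℝ) :
    ∑ i, ∑ j, w i j * ((y i - y j) ⬝ᵥ (y i - y j))
      ≤ 2 * ∑ i, ∑ j, w i j * ((z i - z j) ⬝ᵥ (z i - z j))
        + 8 * ∑ i, ∑ j, w i j * ((z i - y i) ⬝ᵥ (z i - y i)) := by
  have hs := sum_sum_swap hw (fun i _ => (z i - y i) ⬝ᵥ (z i - y i))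
  have key : ∀ i j, (y i - y j) ⬝ᵥ (y i - y j) ≤ 2 * ((z i - z j) ⬝ᵥ (z i - z j))
      + 4 * ((z i - y i) ⬝ᵥ (z i - y i)) + 4 * ((z j - y j) ⬝ᵥ (z j - y j)) := by
    intro i j
    simp only [dotProduct, Finset.mul_sum, ← Finset.sum_add_distrib]
    refine Finset.sum_le_sum fun r _ => ?_
    simp only [Pi.sub_apply]
    nlinarith [sq_nonneg ((z i r - y i r) + (z j r - y j r)),
      sq_nonneg ((z i r - z j r) + ((z i r - y i r) - (z j r - y j r)))]
  have h : ∑ i, ∑ j, w i j * ((y i - y j) ⬝ᵥ (y i - y j)) ≤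
      ∑ i, ∑ j, w i j * (2 * ((z i - z j) ⬝ᵥ (z i - z j))
      + 4 * ((z i - y i) ⬝ᵥ (z i - y i)) + 4 * ((z j - y j) ⬝ᵥ (z j - y j))) :=
    Finset.sum_le_sum fun i _ => Finset.sum_le_sum fun j _ =>
      mul_le_mul_of_nonneg_left (key i j) (hw0 i j)
  simp only [mul_add, Finset.sum_add_distrib, mul_left_comm _ (2 : ℝ), mul_left_comm _ (4 : ℝ),
    ← Finset.mul_sum] at h
  linarith

/-! ### A Poincaré inequality for connected graphs -/

theorem adjMatrix_nonneg {N : ℕ} (G : SimpleGraph (Fin N)) [DecidableRel G.Adj] (i j : Fin N) :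
    0 ≤ G.adjMatrix ℝ i j := by
  rw [SimpleGraph.adjMatrix_apply]; split_ifs <;> norm_num

theorem adjMatrix_symm {N : ℕ} (G : SimpleGraph (Fin N)) [DecidableRel G.Adj] (i j : Fin N) :
    G.adjMatrix ℝ i j = G.adjMatrix ℝ j i := by
  simp only [SimpleGraph.adjMatrix_apply, G.adj_comm]

theorem abs_sub_le_length_mul {N : ℕ} {G : SimpleGraph (Fin N)} {f : Fin N → ℝ} {s : ℝ}
    (h : ∀ i j, G.Adj i j → |f i - f j| ≤ s) {u v : Fin N} (q : G.Walk u v) :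
    |f u - f v| ≤ q.length * s := by
  induction q with
  | nil => simp
  | @cons u v w huv q ih =>
    have h1 := abs_sub_le (f u) (f v) (f w)
    have h2 := h u v huv
    rw [SimpleGraph.Walk.length_cons]
    push_cast
    linarith

/-- In a connected graph the deviations of vectors with mean zero are controlled by
their differences along the edges (the constant replaces the algebraic connectivity). -/
theorem exists_poincare {N : ℕ} (G : SimpleGraph (Fin N)) [DecidableRel G.Adj]
    (hG : G.Connected) : ∃ C : ℝ, 0 ≤ C ∧ ∀ (m : ℕ) (y : Fin N → Fin m → ℝ), ∑ i, y i = 0 →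
      ∑ i, y i ⬝ᵥ y i ≤ C * ∑ i, ∑ j, G.adjMatrix ℝ i j * ((y i - y j) ⬝ᵥ (y i - y j)) := by
  let L : ℝ := ∑ u, ∑ v, (G.dist u v : ℝ)
  have hL : 0 ≤ L := by positivity
  have hN : (0 : ℝ) < N := by
    obtain ⟨i⟩ := hG.nonempty
    exact_mod_cast i.pos
  -- the scalar case
  have hscal : ∀ f : Fin N → ℝ, ∑ i, f i = 0 →
      ∑ i, f i * f i ≤ N * L ^ 2 * ∑ i, ∑ j, G.adjMatrix ℝ i j * ((f i - f j) * (f i - f j)) := by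
    intro f hf
    set D := ∑ i, ∑ j, G.adjMatrix ℝ i j * ((f i - f j) * (f i - f j)) with hD
    have hterm : ∀ i j, 0 ≤ G.adjMatrix ℝ i j * ((f i - f j) * (f i - f j)) := fun i j =>
      mul_nonneg (adjMatrix_nonneg G i j) (mul_self_nonneg _)
    have hD0 : 0 ≤ D := Finset.sum_nonneg fun i _ => Finset.sum_nonneg fun j _ => hterm i j
    have hadj : ∀ i j, G.Adj i j → |f i - f j| ≤ √D := by
      intro i j hij
      refine Real.abs_le_sqrt ?_
      calc (f i - f j) ^ 2 = G.adjMatrix ℝ i j * ((f i - f j) * (f i - f j)) := by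
            simp [SimpleGraph.adjMatrix_apply, hij, pow_two]
        _ ≤ ∑ j, G.adjMatrix ℝ i j * ((f i - f j) * (f i - f j)) :=
            Finset.single_le_sum (f := fun j => G.adjMatrix ℝ i j * ((f i - f j) * (f i - f j)))
              (fun j _ => hterm i j) (Finset.mem_univ j)
        _ ≤ D := Finset.single_le_sum
              (f := fun i => ∑ j, G.adjMatrix ℝ i j * ((f i - f j) * (f i - f j)))
              (fun i _ => Finset.sum_nonneg fun j _ => hterm i j) (Finset.mem_univ i)
    have hpair : ∀ u v, |f u - f v| ≤ L * √D := by
      intro u v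
      obtain ⟨q, hq⟩ := hG.exists_walk_length_eq_dist u v
      refine (abs_sub_le_length_mul hadj q).trans ?_
      refine mul_le_mul_of_nonneg_right ?_ (Real.sqrt_nonneg _)
      rw [hq]
      calc (G.dist u v : ℝ) ≤ ∑ v, (G.dist u v : ℝ) :=
            Finset.single_le_sum (f := fun v => (G.dist u v : ℝ)) (fun v _ => by positivity)
              (Finset.mem_univ v)
        _ ≤ L := Finset.single_le_sum (f := fun u => ∑ v, (G.dist u v : ℝ))
              (fun u _ => by positivity) (Finset.mem_univ u)
    -- since `f` has mean zero, `f i` is the average of the differences `f i - f j`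
    have hone : ∀ i, f i * f i ≤ L ^ 2 * D := by
      intro i
      have h1 : N * f i = ∑ j, (f i - f j) := by
        rw [Finset.sum_sub_distrib, hf]; simp
      have h2 : N * |f i| ≤ N * (L * √D) := by
        calc N * |f i| = |N * f i| := by rw [abs_mul, abs_of_pos hN]
          _ ≤ ∑ j, |f i - f j| := by rw [h1]; exact Finset.abs_sum_le_sum_abs _ _
          _ ≤ ∑ _j : Fin N, L * √D := Finset.sum_le_sum fun j _ => hpair i j
          _ = N * (L * √D) := by simp
      have h3 : |f i| ≤ L * √D := le_of_mul_le_mul_left h2 hN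
      calc f i * f i = |f i| * |f i| := (abs_mul_abs_self _).symm
        _ ≤ (L * √D) * (L * √D) := mul_self_le_mul_self (abs_nonneg _) h3
        _ = L ^ 2 * (√D * √D) := by ring
        _ = L ^ 2 * D := by rw [Real.mul_self_sqrt hD0]
    calc ∑ i, f i * f i ≤ ∑ _i : Fin N, L ^ 2 * D := Finset.sum_le_sum fun i _ => hone i
      _ = N * L ^ 2 * D := by simp; ring
  refine ⟨N * L ^ 2, by positivity, fun m y hy => ?_⟩
  have h : ∑ r, ∑ i, y i r * y i r ≤ ∑ r, N * L ^ 2 *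
      ∑ i, ∑ j, G.adjMatrix ℝ i j * ((y i r - y j r) * (y i r - y j r)) :=
    Finset.sum_le_sum fun r _ => hscal (fun i => y i r) (by simpa using congrFun hy r)
  have e1 : ∑ i, y i ⬝ᵥ y i = ∑ r, ∑ i, y i r * y i r := by
    simp only [dotProduct]
    exact Finset.sum_comm
  have e2 : ∑ i, ∑ j, G.adjMatrix ℝ i j * ((y i - y j) ⬝ᵥ (y i - y j))
      = ∑ r, ∑ i, ∑ j, G.adjMatrix ℝ i j * ((y i r - y j r) * (y i r - y j r)) := by
    simp only [dotProduct, Finset.mul_sum]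
    refine (Finset.sum_congr rfl fun i _ => Finset.sum_comm).trans Finset.sum_comm
  rw [e1, e2, Finset.mul_sum]
  exact h

/-! ### Dissipation along the closed loop -/

theorem weight_mul_adjMatrix_nonneg {N : ℕ} {G : SimpleGraph (Fin N)} [DecidableRel G.Adj]
    {c : Fin N → Fin N → ℝ} (hc : ∀ i j, G.Adj i j → 0 ≤ c i j) (i j : Fin N) :
    0 ≤ c i j * G.adjMatrix ℝ i j := by
  by_cases h : G.Adj i j <;> simp [SimpleGraph.adjMatrix_apply, h, hc]

theorem weight_mul_adjMatrix_symm {N : ℕ} {G : SimpleGraph (Fin N)} [DecidableRel G.Adj]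
    {c : Fin N → Fin N → ℝ} (hc : ∀ i j, G.Adj i j → c i j = c j i) (i j : Fin N) :
    c i j * G.adjMatrix ℝ i j = c j i * G.adjMatrix ℝ j i := by
  by_cases h : G.Adj i j
  · rw [hc i j h, adjMatrix_symm]
  · simp [SimpleGraph.adjMatrix_apply, h, G.adj_comm j i]

theorem quadForm_gain_nonneg {n p : ℕ} {P : Matrix (Fin n) (Fin n) ℝ} (hP : P.IsHermitian)
    (B : Matrix (Fin n) (Fin p) ℝ) (v : Fin n → ℝ) : 0 ≤ quadForm (P * B * Bᵀ * P) v := by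
  rw [quadForm_eq_normSq P hP]
  exact zero_le_dotProduct_self _

theorem quadForm_sub_comm {n : ℕ} (Γ : Matrix (Fin n) (Fin n) ℝ) (v w : Fin n → ℝ) :
    quadForm Γ (v - w) = quadForm Γ (w - v) := by
  rw [← neg_sub w v, quadForm, Matrix.mulVec_neg, neg_dotProduct_neg, quadForm]

theorem sum_consensusError {N n : ℕ} (hN : 0 < N) (x : ℝ → Fin N → Fin n → ℝ) (t : ℝ) :
    ∑ i, consensusError x t i = 0 := by
  have hN' : (N : ℝ) ≠ 0 := by exact_mod_cast hN.ne'
  ext r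
  simp only [consensusError, Finset.sum_apply, Pi.sub_apply, Pi.smul_apply, smul_eq_mul,
    Finset.sum_sub_distrib, Finset.sum_const, Finset.card_univ, Fintype.card_fin, nsmul_eq_mul,
    Pi.zero_apply]
  field_simp
  ring

/-- By the Riccati equation, `2 ξᵀ P (A ξ + B u) = |Bᵀ P ξ|² - |ξ|² + 2 (Bᵀ P ξ)ᵀ u`. -/
theorem two_mul_dotProduct_riccati {n p : ℕ} {A P : Matrix (Fin n) (Fin n) ℝ}
    {B : Matrix (Fin n) (Fin p) ℝ} (hP : P.IsHermitian)
    (hARE : P * A + Aᵀ * P - P * B * Bᵀ * P + 1 = 0) (v : Fin n → ℝ) (u : Fin p → ℝ) :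
    2 * (v ⬝ᵥ (P *ᵥ (A *ᵥ v + B *ᵥ u)))
      = ((Bᵀ * P) *ᵥ v) ⬝ᵥ ((Bᵀ * P) *ᵥ v) - v ⬝ᵥ v + 2 * (((Bᵀ * P) *ᵥ v) ⬝ᵥ u) := by
  have hPt : Pᵀ = P := by simpa [Matrix.IsHermitian] using hP
  have hsum : P * A + Aᵀ * P = P * B * Bᵀ * P - 1 := by
    rw [← sub_eq_zero, ← hARE]; abel
  have h1 : v ⬝ᵥ ((P * A) *ᵥ v) = v ⬝ᵥ ((Aᵀ * P) *ᵥ v) := by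
    rw [Matrix.dotProduct_mulVec, ← Matrix.mulVec_transpose, Matrix.transpose_mul, hPt,
      dotProduct_comm]
  have h2 : v ⬝ᵥ ((P * A) *ᵥ v) + v ⬝ᵥ ((Aᵀ * P) *ᵥ v)
      = ((Bᵀ * P) *ᵥ v) ⬝ᵥ ((Bᵀ * P) *ᵥ v) - v ⬝ᵥ v := by
    rw [← dotProduct_add, ← Matrix.add_mulVec, hsum, Matrix.sub_mulVec, dotProduct_sub,
      Matrix.one_mulVec, ← quadForm_eq_normSq P hP, quadForm]
  have h3 : v ⬝ᵥ ((P * B) *ᵥ u) = ((Bᵀ * P) *ᵥ v) ⬝ᵥ u := by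
    rw [Matrix.dotProduct_mulVec, ← Matrix.mulVec_transpose, Matrix.transpose_mul, hPt]
  rw [Matrix.mulVec_add, dotProduct_add, Matrix.mulVec_mulVec, Matrix.mulVec_mulVec, h3]
  linarith

/-- The rate of the Lyapunov function `∑ ξᵢᵀ P ξᵢ + (1/4) ∑ aᵢⱼ (cᵢⱼ - α)² / κᵢⱼ` with
`α = 8 C + 1 / δ`, where `C` is a Poincaré constant of the graph and `m` bounds the threshold of
the triggering functions. -/
theorem dissipation {N n p : ℕ} {A P : Matrix (Fin n) (Fin n) ℝ} {B : Matrix (Fin n) (Fin p) ℝ}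
    (hP : P.IsHermitian) (hARE : P * A + Aᵀ * P - P * B * Bᵀ * P + 1 = 0)
    {G : SimpleGraph (Fin N)} [DecidableRel G.Adj] (hN : 0 < N) {C : ℝ} (hC0 : 0 ≤ C)
    (hC : ∀ (m : ℕ) (y : Fin N → Fin m → ℝ), ∑ i, y i = 0 →
      ∑ i, y i ⬝ᵥ y i ≤ C * ∑ i, ∑ j, G.adjMatrix ℝ i j * ((y i - y j) ⬝ᵥ (y i - y j)))
    {c : Fin N → Fin N → ℝ} (hc : ∀ i j, G.Adj i j → c i j = c j i)
    (hc0 : ∀ i j, G.Adj i j → 0 ≤ c i j) {δ m : ℝ} (hδ : 0 < δ)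
    (x : ℝ → Fin N → Fin n → ℝ) (t : ℝ) (z : Fin N → Fin n → ℝ)
    (htrig : ∀ i, ∑ j, (1 + δ * c i j) * G.adjMatrix ℝ i j *
        quadForm (P * B * Bᵀ * P) (z i - x t i)
      - 1 / 4 * ∑ j, G.adjMatrix ℝ i j * quadForm (P * B * Bᵀ * P) (z i - z j) ≤ m) :
    ∑ i, 2 * (consensusError x t i ⬝ᵥ (P *ᵥ (A *ᵥ consensusError x t i
        + B *ᵥ controlInput G (-(Bᵀ * P)) c z i)))
      + 1 / 2 * ∑ i, ∑ j, G.adjMatrix ℝ i j * (c i j - (8 * C + 1 / δ)) *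
        quadForm (P * B * Bᵀ * P) (z i - z j)
      ≤ -∑ i, consensusError x t i ⬝ᵥ consensusError x t i + (8 * C + 2 / δ) * (N * m) := by
  set H := Bᵀ * P with hH
  set ξ := consensusError x t with hξ
  set xm : Fin n → ℝ := (1 / (N : ℝ)) • ∑ j, x t j with hxm
  set w : Fin N → Fin N → ℝ := fun i j => c i j * G.adjMatrix ℝ i j with hw
  -- in the coordinates `H v` the matrix `Γ` becomes the identity
  set y : Fin N → Fin p → ℝ := fun i => H *ᵥ ξ i with hy
  set zz : Fin N → Fin p → ℝ := fun i => H *ᵥ (z i - xm) with hzz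
  have hws : ∀ i j, w i j = w j i := weight_mul_adjMatrix_symm hc
  have hw0 : ∀ i j, 0 ≤ w i j := weight_mul_adjMatrix_nonneg hc0
  have hzdiff : ∀ i j, zz i - zz j = H *ᵥ (z i - z j) := by
    intro i j
    simp only [hzz, ← Matrix.mulVec_sub]
    congr 1; abel
  have hzy : ∀ i, zz i - y i = H *ᵥ (z i - x t i) := by
    intro i
    simp only [hzz, hy, ← Matrix.mulVec_sub]
    congr 1
    simp only [hξ, consensusError, hxm]; abel
  have hu : ∀ i, controlInput G (-H) c z i = -∑ j, w i j • (zz i - zz j) := by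
    intro i
    rw [controlInput, Matrix.neg_mulVec]
    simp only [Matrix.mulVec_sum, Matrix.mulVec_smul, hzdiff, hw]
  have hΓ : ∀ v, quadForm (P * B * Bᵀ * P) v = (H *ᵥ v) ⬝ᵥ (H *ᵥ v) := quadForm_eq_normSq P hP B
  simp only [hΓ, ← hzy, ← hzdiff] at htrig ⊢
  have hV : ∑ i, 2 * (ξ i ⬝ᵥ (P *ᵥ (A *ᵥ ξ i + B *ᵥ controlInput G (-H) c z i)))
      = ∑ i, y i ⬝ᵥ y i - ∑ i, ξ i ⬝ᵥ ξ i
        - 2 * ∑ i, y i ⬝ᵥ ∑ j, w i j • (zz i - zz j) := by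
    simp only [two_mul_dotProduct_riccati hP hARE, hu, Finset.sum_add_distrib,
      Finset.sum_sub_distrib, dotProduct_neg, mul_neg, Finset.sum_neg_distrib, ← Finset.mul_sum]
    rfl
  have hpoin := hC p y (by
    simp only [hy, ← Matrix.mulVec_sum, hξ, sum_consensusError hN, Matrix.mulVec_zero])
  have hcoup := coupling_le hws hw0 y zz
  have hdis := sum_disagreement_le (adjMatrix_symm G) (adjMatrix_nonneg G) y zz
  set Q := ∑ i, ∑ j, G.adjMatrix ℝ i j * ((zz i - zz j) ⬝ᵥ (zz i - zz j)) with hQ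
  set CQ := ∑ i, ∑ j, w i j * ((zz i - zz j) ⬝ᵥ (zz i - zz j)) with hCQ
  set E := ∑ i, ∑ j, G.adjMatrix ℝ i j * ((zz i - y i) ⬝ᵥ (zz i - y i)) with hE
  set F := ∑ i, ∑ j, w i j * ((zz i - y i) ⬝ᵥ (zz i - y i)) with hF
  have hE0 : 0 ≤ E := Finset.sum_nonneg fun i _ => Finset.sum_nonneg fun j _ =>
    mul_nonneg (adjMatrix_nonneg G i j) (zero_le_dotProduct_self _)
  have hF0 : 0 ≤ F := Finset.sum_nonneg fun i _ => Finset.sum_nonneg fun j _ =>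
    mul_nonneg (hw0 i j) (zero_le_dotProduct_self _)
  -- the triggering inequality, summed over all agents
  have htr : E + δ * F - 1 / 4 * Q ≤ N * m := by
    have h := Finset.sum_le_sum fun i (_ : i ∈ Finset.univ) => htrig i
    rw [Finset.sum_sub_distrib, ← Finset.mul_sum] at h
    have e : ∑ i, ∑ j, (1 + δ * c i j) * G.adjMatrix ℝ i j * ((zz i - y i) ⬝ᵥ (zz i - y i))
        = E + δ * F := by
      rw [hE, hF, Finset.mul_sum, ← Finset.sum_add_distrib]
      refine Finset.sum_congr rfl fun i _ => ?_
      rw [Finset.mul_sum, ← Finset.sum_add_distrib]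
      refine Finset.sum_congr rfl fun j _ => ?_
      simp only [hw]; ring
    rw [e, Finset.sum_const, Finset.card_univ, Fintype.card_fin, nsmul_eq_mul] at h
    exact h
  have hlast : ∑ i, ∑ j, G.adjMatrix ℝ i j * (c i j - (8 * C + 1 / δ)) *
      ((zz i - zz j) ⬝ᵥ (zz i - zz j)) = CQ - (8 * C + 1 / δ) * Q := by
    rw [hCQ, hQ, Finset.mul_sum, ← Finset.sum_sub_distrib]
    refine Finset.sum_congr rfl fun i _ => ?_
    rw [Finset.mul_sum, ← Finset.sum_sub_distrib]
    refine Finset.sum_congr rfl fun j _ => ?_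
    simp only [hw]; ring
  rw [hV, hlast]
  -- `c ≥ 0` allows using the triggering inequality separately for `E` and for `δ F`
  have hE1 : E ≤ 1 / 4 * Q + N * m := by nlinarith [mul_nonneg hδ.le hF0]
  have hF1 : F ≤ 1 / δ * (1 / 4 * Q + N * m) := by
    rw [one_div_mul_eq_div, le_div_iff₀ hδ]; linarith
  have hY := hpoin.trans (mul_le_mul_of_nonneg_left
    (hdis.trans (add_le_add_right (mul_le_mul_of_nonneg_left hE1 (by norm_num : (0:ℝ) ≤ 8)) _)) hC0)
  have e1 : (2 : ℝ) / δ = 2 * (1 / δ) := by ring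
  rw [e1]
  linarith

/-! ### Functions with prescribed right derivatives -/

/-- Comparison of increments; right derivatives suffice, as needed at the jumps of the inputs. -/
theorem sub_le_sub_of_right_deriv {T : EReal} {f f' g g' : ℝ → ℝ}
    (hf : ContinuousOn f {t : ℝ | 0 ≤ t ∧ (t : EReal) < T})
    (hf' : ∀ t : ℝ, 0 ≤ t → (t : EReal) < T → HasDerivWithinAt f (f' t) (Set.Ici t) t)
    (hg : ContinuousOn g {t : ℝ | 0 ≤ t ∧ (t : EReal) < T})
    (hg' : ∀ t : ℝ, 0 ≤ t → (t : EReal) < T → HasDerivWithinAt g (g' t) (Set.Ici t) t)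
    {s t : ℝ} (h : ∀ r : ℝ, s ≤ r → (r : EReal) < T → f' r ≤ g' r)
    (hs : 0 ≤ s) (hst : s ≤ t) (ht : (t : EReal) < T) : f t - f s ≤ g t - g s := by
  have hlt : ∀ r : ℝ, r ≤ t → (r : EReal) < T := fun r hr =>
    lt_of_le_of_lt (EReal.coe_le_coe_iff.2 hr) ht
  have hsub : Set.Icc s t ⊆ {t : ℝ | 0 ≤ t ∧ (t : EReal) < T} := fun r hr =>
    ⟨hs.trans hr.1, hlt r hr.2⟩
  have key := image_le_of_deriv_right_le_deriv_boundary (hf.mono hsub)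
    (fun r hr => hf' r (hs.trans hr.1) (hlt r hr.2.le))
    (B := fun r => f s + (g r - g s)) (B' := g') (by simp)
    (continuousOn_const.add ((hg.mono hsub).sub continuousOn_const))
    (fun r hr => ((hg' r (hs.trans hr.1) (hlt r hr.2.le)).sub_const _).const_add _)
    (fun r hr => h r hr.1 (hlt r hr.2.le)) (Set.right_mem_Icc.2 hst)
  linarith

theorem norm_sub_le_sub_of_right_deriv {E : Type*} [NormedAddCommGroup E] [NormedSpace ℝ E]
    {T : EReal} {f f' : ℝ → E} {g g' : ℝ → ℝ}
    (hf : ContinuousOn f {t : ℝ | 0 ≤ t ∧ (t : EReal) < T})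
    (hf' : ∀ t : ℝ, 0 ≤ t → (t : EReal) < T → HasDerivWithinAt f (f' t) (Set.Ici t) t)
    (hg : ContinuousOn g {t : ℝ | 0 ≤ t ∧ (t : EReal) < T})
    (hg' : ∀ t : ℝ, 0 ≤ t → (t : EReal) < T → HasDerivWithinAt g (g' t) (Set.Ici t) t)
    (h : ∀ r : ℝ, 0 ≤ r → (r : EReal) < T → ‖f' r‖ ≤ g' r)
    {s t : ℝ} (hs : 0 ≤ s) (hst : s ≤ t) (ht : (t : EReal) < T) : ‖f t - f s‖ ≤ g t - g s := by
  have hlt : ∀ r : ℝ, r ≤ t → (r : EReal) < T := fun r hr =>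
    lt_of_le_of_lt (EReal.coe_le_coe_iff.2 hr) ht
  have hsub : Set.Icc s t ⊆ {t : ℝ | 0 ≤ t ∧ (t : EReal) < T} := fun r hr =>
    ⟨hs.trans hr.1, hlt r hr.2⟩
  exact image_norm_le_of_norm_deriv_right_le_deriv_boundary' (f := fun r => f r - f s)
    ((hf.mono hsub).sub continuousOn_const)
    (fun r hr => (hf' r (hs.trans hr.1) (hlt r hr.2.le)).sub_const _)
    (B := fun r => g r - g s) (B' := g') (by simp)
    ((hg.mono hsub).sub continuousOn_const)
    (fun r hr => (hg' r (hs.trans hr.1) (hlt r hr.2.le)).sub_const _)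
    (fun r hr => h r (hs.trans hr.1) (hlt r hr.2.le)) (Set.right_mem_Icc.2 hst)

/-! ### Event instants -/

section Events

variable {N n p : ℕ} {G : SimpleGraph (Fin N)} [DecidableRel G.Adj]
  {A : Matrix (Fin n) (Fin n) ℝ} {B : Matrix (Fin n) (Fin p) ℝ} {K : Matrix (Fin p) (Fin n) ℝ}
  {Γ : Matrix (Fin n) (Fin n) ℝ} {κ ϱ : Fin N → Fin N → ℝ} {δ μ ν : ℝ}
  {x xt : ℝ → Fin N → Fin n → ℝ} {c : ℝ → Fin N → Fin N → ℝ} {τ : Fin N → ℕ → EReal}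

theorem IsClosedLoop.event_mono (h : IsClosedLoop G A B K Γ κ ϱ δ μ ν x xt c τ) (i : Fin N) :
    Monotone (τ i) := by
  refine monotone_nat_of_le_succ fun k => ?_
  obtain ⟨z, -, hz⟩ := h.event_succ i k
  rw [hz]
  refine le_sInf ?_
  rintro _ ⟨t, ht, rfl⟩
  exact ht.1.le

theorem IsClosedLoop.event_nonneg (h : IsClosedLoop G A B K Γ κ ϱ δ μ ν x xt c τ) (i : Fin N)
    (k : ℕ) : 0 ≤ τ i k := by
  rw [← h.event_zero i]
  exact h.event_mono i (Nat.zero_le k)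

theorem IsClosedLoop.exists_interval (h : IsClosedLoop G A B K Γ κ ϱ δ μ ν x xt c τ) (i : Fin N)
    {t : ℝ} (ht0 : 0 ≤ t) (ht : (t : EReal) < horizon τ) :
    ∃ k, τ i k ≤ (t : EReal) ∧ (t : EReal) < τ i (k + 1) := by
  classical
  have hex : ∃ k, (t : EReal) < τ i k := lt_iSup_iff.1 (ht.trans_le (iInf_le _ i))
  have h0 : Nat.find hex ≠ 0 := by
    intro h0
    have := Nat.find_spec hex
    rw [h0, h.event_zero i] at this
    exact absurd (EReal.coe_nonneg.2 ht0) (not_le.2 this)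
  obtain ⟨k, hk⟩ := Nat.exists_eq_succ_of_ne_zero h0
  refine ⟨k, not_lt.1 (Nat.find_min hex (by omega)), ?_⟩
  have := Nat.find_spec hex
  rwa [hk] at this

theorem continuous_estimate (i : Fin N) (k : ℕ) : Continuous (estimate A τ x i k) := by
  unfold estimate
  refine Continuous.matrix_mulVec ?_ continuous_const
  open scoped Matrix.Norms.Operator in
  exact (NormedSpace.exp_continuous (𝔸 := Matrix (Fin n) (Fin n) ℝ)).comp (by fun_prop)

theorem IsClosedLoop.state_rightContinuous (h : IsClosedLoop G A B K Γ κ ϱ δ μ ν x xt c τ) {t : ℝ}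
    (ht0 : 0 ≤ t) (ht : (t : EReal) < horizon τ) (i : Fin N) :
    Tendsto (fun s => x s i) (𝓝[>] t) (𝓝 (x t i)) :=
  ((h.state_deriv t ht0 ht i).continuousWithinAt.mono Set.Ioi_subset_Ici_self).tendsto

theorem IsClosedLoop.weight_rightContinuous (h : IsClosedLoop G A B K Γ κ ϱ δ μ ν x xt c τ) {t : ℝ}
    (ht0 : 0 ≤ t) (ht : (t : EReal) < horizon τ) (i j : Fin N) :
    Tendsto (fun s => c s i j) (𝓝[>] t) (𝓝 (c t i j)) :=
  ((h.weight_deriv t ht0 ht i j).continuousWithinAt.mono Set.Ioi_subset_Ici_self).tendsto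

theorem continuous_quadForm (Γ : Matrix (Fin n) (Fin n) ℝ) : Continuous (quadForm Γ) := by
  unfold quadForm; fun_prop

theorem triggerFn_tendsto {l : Filter ℝ} {C : ℝ → Fin N → Fin N → ℝ} {C₀ : Fin N → Fin N → ℝ}
    {X Z : ℝ → Fin N → Fin n → ℝ} {X₀ Z₀ : Fin N → Fin n → ℝ} {t : ℝ} (i : Fin N)
    (hC : ∀ j, Tendsto (fun s => C s i j) l (𝓝 (C₀ i j)))
    (hX : Tendsto (fun s => X s i) l (𝓝 (X₀ i)))
    (hZ : ∀ j, Tendsto (fun s => Z s j) l (𝓝 (Z₀ j))) (hl : Tendsto id l (𝓝 t)) :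
    Tendsto (fun s => triggerFn G Γ δ μ ν (C s) i (X s i) (Z s i) (Z s) s) l
      (𝓝 (triggerFn G Γ δ μ ν C₀ i (X₀ i) (Z₀ i) Z₀ t)) := by
  unfold triggerFn
  refine Tendsto.sub (Tendsto.sub ?_ ?_) ?_
  · refine tendsto_finsetSum _ fun j _ => ?_
    exact ((((hC j).const_mul δ).const_add 1).mul_const _).mul
      (((continuous_quadForm Γ).tendsto _).comp ((hZ i).sub hX))
  · refine Tendsto.const_mul _ (tendsto_finsetSum _ fun j _ => ?_)
    exact (((continuous_quadForm Γ).tendsto _).comp ((hZ i).sub (hZ j))).const_mul _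
  · have : Continuous fun s : ℝ => μ * Real.exp (-ν * s) := by fun_prop
    exact (this.tendsto t).comp hl

/-- The triggering function, evaluated with the current estimates, is nowhere positive: it is
negative in the interior of the common intervals between events, and every time before the horizon
is the left end of such an interval. This disposes of the times at which a neighbour broadcasts. -/
theorem IsClosedLoop.triggerFn_nonpos (h : IsClosedLoop G A B K Γ κ ϱ δ μ ν x xt c τ) {t : ℝ}
    (ht0 : 0 ≤ t) (ht : (t : EReal) < horizon τ) (i : Fin N) :
    triggerFn G Γ δ μ ν (c t) i (x t i) (xt t i) (xt t) t ≤ 0 := by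
  choose k hk1 hk2 using fun j => h.exists_interval j ht0 ht
  have hlim := triggerFn_tendsto (G := G) (Γ := Γ) (δ := δ) (μ := μ) (ν := ν) i
    (fun j => h.weight_rightContinuous ht0 ht i j) (h.state_rightContinuous ht0 ht i)
    (fun j => ((continuous_estimate (A := A) (τ := τ) (x := x) j (k j)).tendsto t).mono_left
      (nhdsWithin_le_nhds (s := Set.Ioi t))) (tendsto_id.mono_left nhdsWithin_le_nhds)
  have hxt : xt t = fun j => estimate A τ x j (k j) t :=
    funext fun j => h.estimate_eq j (k j) t (hk1 j) (hk2 j)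
  rw [hxt]
  refine le_of_tendsto hlim ?_
  have hev : ∀ b : EReal, (t : EReal) < b → ∀ᶠ s : ℝ in 𝓝[>] t, (s : EReal) < b := fun b hb =>
    nhdsWithin_le_nhds ((continuous_coe_real_ereal.tendsto t).eventually (gt_mem_nhds hb))
  have hall : ∀ᶠ s : ℝ in 𝓝[>] t, ∀ j, (s : EReal) < τ j (k j + 1) :=
    eventually_all.2 fun j => hev _ (hk2 j)
  filter_upwards [hall, hev _ ht, self_mem_nhdsWithin] with s hs hsT hts
  have hts' : (t : EReal) < s := EReal.coe_lt_coe_iff.2 hts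
  obtain ⟨z, hz, hτ⟩ := h.event_succ i (k i)
  have hzs : z s = fun j => estimate A τ x j (k j) s := by
    funext j
    rcases hz s j with hz | ⟨m, hm, -⟩
    · rw [hz]
      exact h.estimate_eq j (k j) s ((hk1 j).trans hts'.le) (hs j)
    · -- there are no events strictly inside the interval
      exfalso
      rcases le_or_gt (m + 1) (k j) with hle | hlt
      · exact absurd (hm ▸ (h.event_mono j hle).trans (hk1 j)) (not_le.2 hts')
      · exact absurd (hm ▸ h.event_mono j (Nat.succ_le_of_lt hlt)) (not_le.2 (hs j))
  by_contra hcon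
  have hmem : (s : EReal) ∈ ((fun t : ℝ => (t : EReal)) '' {t : ℝ | τ i (k i) < (t : EReal) ∧
      (t : EReal) < horizon τ ∧
      0 ≤ triggerFn G Γ δ μ ν (c t) i (x t i) (estimate A τ x i (k i) t) (z t) t}) := by
    refine ⟨s, ⟨(hk1 i).trans_lt hts', hsT, ?_⟩, rfl⟩
    rw [hzs]
    exact (not_le.1 hcon).le
  exact absurd (hτ ▸ sInf_le hmem) (not_le.2 (hs i))

/-! ### Coupling weights -/

theorem IsClosedLoop.weight_continuousOn (h : IsClosedLoop G A B K Γ κ ϱ δ μ ν x xt c τ)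
    (i j : Fin N) :
    ContinuousOn (fun t => c t i j) {t : ℝ | 0 ≤ t ∧ (t : EReal) < horizon τ} :=
  continuousOn_pi.1 (continuousOn_pi.1 h.weight_continuous i) j

theorem IsClosedLoop.state_continuousOn (h : IsClosedLoop G A B K Γ κ ϱ δ μ ν x xt c τ)
    (i : Fin N) :
    ContinuousOn (fun t => x t i) {t : ℝ | 0 ≤ t ∧ (t : EReal) < horizon τ} :=
  continuousOn_pi.1 h.state_continuous i

theorem IsClosedLoop.weight_deriv_of_adj (h : IsClosedLoop G A B K Γ κ ϱ δ μ ν x xt c τ)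
    (hϱ : ∀ i j, G.Adj i j → ϱ i j = 0) {t : ℝ} (ht0 : 0 ≤ t) (ht : (t : EReal) < horizon τ)
    {i j : Fin N} (hij : G.Adj i j) :
    HasDerivWithinAt (fun s => c s i j) (κ i j * quadForm Γ (xt t i - xt t j)) (Set.Ici t) t := by
  have := h.weight_deriv t ht0 ht i j
  simpa [adaptiveLaw, hϱ i j hij, SimpleGraph.adjMatrix_apply, hij] using this

theorem IsClosedLoop.weight_symm (h : IsClosedLoop G A B K Γ κ ϱ δ μ ν x xt c τ)
    (hϱ : ∀ i j, G.Adj i j → ϱ i j = 0) (hκ_symm : ∀ i j, G.Adj i j → κ i j = κ j i)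
    (hc_symm : ∀ i j, G.Adj i j → c 0 i j = c 0 j i) {t : ℝ} (ht0 : 0 ≤ t)
    (ht : (t : EReal) < horizon τ) (i j : Fin N) (hij : G.Adj i j) : c t i j = c t j i := by
  have key : ∀ i j, G.Adj i j → c t i j - c 0 i j ≤ c t j i - c 0 j i := fun i j hij =>
    sub_le_sub_of_right_deriv (h.weight_continuousOn i j)
      (fun s hs0 hs => h.weight_deriv_of_adj hϱ hs0 hs hij) (h.weight_continuousOn j i)
      (fun s hs0 hs => h.weight_deriv_of_adj hϱ hs0 hs hij.symm)
      (fun s _ _ => by rw [quadForm_sub_comm, hκ_symm i j hij]) le_rfl ht0 ht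
  have h1 := key i j hij
  have h2 := key j i hij.symm
  have h3 := hc_symm i j hij
  linarith

/-- Without `σ`-modification the weights of the edges never decrease. -/
theorem IsClosedLoop.weight_mono (h : IsClosedLoop G A B K Γ κ ϱ δ μ ν x xt c τ)
    (hϱ : ∀ i j, G.Adj i j → ϱ i j = 0) (hκ : ∀ i j, G.Adj i j → 0 < κ i j)
    (hΓ : ∀ v, 0 ≤ quadForm Γ v) {i j : Fin N} (hij : G.Adj i j) {s t : ℝ} (hs0 : 0 ≤ s)
    (hst : s ≤ t) (ht : (t : EReal) < horizon τ) : c s i j ≤ c t i j := by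
  have := sub_le_sub_of_right_deriv (f := fun _ => (0 : ℝ)) (f' := fun _ => 0)
    continuousOn_const (fun s _ _ => hasDerivWithinAt_const _ _ _) (h.weight_continuousOn i j)
    (fun s hs0 hs => h.weight_deriv_of_adj hϱ hs0 hs hij)
    (fun s _ _ => mul_nonneg (hκ i j hij).le (hΓ _)) hs0 hst ht
  linarith

end Events

/-! ### The Lyapunov function -/

/-- The Lyapunov function: the weighted size of the consensus error, the deviation of the coupling
weights of the edges from a reference value `α`, and a term that pays for the threshold of the
triggering functions. -/
noncomputable def lyapunov {N n : ℕ} (G : SimpleGraph (Fin N)) [DecidableRel G.Adj]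
    (P : Matrix (Fin n) (Fin n) ℝ) (κ : Fin N → Fin N → ℝ) (α β ν : ℝ) (x : ℝ → Fin N → Fin n → ℝ)
    (c : ℝ → Fin N → Fin N → ℝ) (t : ℝ) : ℝ :=
  ∑ i, quadForm P (consensusError x t i)
    + 1 / 4 * ∑ i, ∑ j, G.adjMatrix ℝ i j / κ i j * (c t i j - α) ^ 2
    + β * Real.exp (-ν * t)

theorem quadForm_hasDerivWithinAt {n : ℕ} {P : Matrix (Fin n) (Fin n) ℝ} (hP : P.IsHermitian)
    {f : ℝ → Fin n → ℝ} {f' : Fin n → ℝ} {s : Set ℝ} {t : ℝ} (hf : HasDerivWithinAt f f' s t) :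
    HasDerivWithinAt (fun r => quadForm P (f r)) (2 * (f t ⬝ᵥ (P *ᵥ f'))) s t := by
  have hPt : Pᵀ = P := by simpa [Matrix.IsHermitian] using hP
  have hfi := hasDerivWithinAt_pi.1 hf
  have key : HasDerivWithinAt (fun r => ∑ i, f r i * ∑ j, P i j * f r j)
      (∑ i, (f' i * ∑ j, P i j * f t j + f t i * ∑ j, P i j * f' j)) s t :=
    HasDerivWithinAt.fun_sum fun i _ =>
      (hfi i).mul (HasDerivWithinAt.fun_sum fun j _ => (hfi j).const_mul (P i j))
  have e : f' ⬝ᵥ (P *ᵥ f t) = f t ⬝ᵥ (P *ᵥ f') := by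
    rw [Matrix.dotProduct_mulVec, ← Matrix.mulVec_transpose, hPt, dotProduct_comm]
  refine HasDerivWithinAt.congr_deriv (f := fun r => quadForm P (f r)) key ?_
  rw [Finset.sum_add_distrib]
  change f' ⬝ᵥ (P *ᵥ f t) + f t ⬝ᵥ (P *ᵥ f') = _
  rw [e]; ring

section Lyapunov

variable {N n p : ℕ} {G : SimpleGraph (Fin N)} [DecidableRel G.Adj]
  {A P : Matrix (Fin n) (Fin n) ℝ} {B : Matrix (Fin n) (Fin p) ℝ} {K : Matrix (Fin p) (Fin n) ℝ}
  {Γ : Matrix (Fin n) (Fin n) ℝ} {κ ϱ : Fin N → Fin N → ℝ} {δ μ ν α β : ℝ}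
  {x xt : ℝ → Fin N → Fin n → ℝ} {c : ℝ → Fin N → Fin N → ℝ} {τ : Fin N → ℕ → EReal}

theorem sum_controlInput {c : Fin N → Fin N → ℝ} (hc : ∀ i j, G.Adj i j → c i j = c j i)
    (z : Fin N → Fin n → ℝ) : ∑ i, controlInput G K c z i = 0 := by
  simp only [controlInput, ← Matrix.mulVec_sum]
  rw [sum_sum_smul_sub_eq_zero (w := fun i j => c i j * G.adjMatrix ℝ i j)
    (weight_mul_adjMatrix_symm hc), Matrix.mulVec_zero]

/-- The inputs of all agents add up to zero since the weights are symmetric. -/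
theorem IsClosedLoop.consensusError_deriv (h : IsClosedLoop G A B K Γ κ ϱ δ μ ν x xt c τ) {t : ℝ}
    (ht0 : 0 ≤ t) (ht : (t : EReal) < horizon τ) (hc : ∀ i j, G.Adj i j → c t i j = c t j i)
    (i : Fin N) :
    HasDerivWithinAt (fun s => consensusError x s i)
      (A *ᵥ consensusError x t i + B *ᵥ controlInput G K (c t) (xt t) i) (Set.Ici t) t := by
  have hsum : HasDerivWithinAt (fun s => ∑ j, x s j)
      (∑ j, (A *ᵥ x t j + B *ᵥ controlInput G K (c t) (xt t) j)) (Set.Ici t) t :=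
    HasDerivWithinAt.fun_sum fun j _ => h.state_deriv t ht0 ht j
  have key := (h.state_deriv t ht0 ht i).sub (hsum.const_smul (1 / (N : ℝ)))
  refine HasDerivWithinAt.congr_deriv (f := fun s => consensusError x s i) key ?_
  rw [Finset.sum_add_distrib, ← Matrix.mulVec_sum, ← Matrix.mulVec_sum, sum_controlInput hc,
    Matrix.mulVec_zero, add_zero, consensusError, Matrix.mulVec_sub, Matrix.mulVec_smul]
  abel

theorem IsClosedLoop.consensusError_continuousOn
    (h : IsClosedLoop G A B K Γ κ ϱ δ μ ν x xt c τ) (i : Fin N) :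
    ContinuousOn (fun t => consensusError x t i) {t : ℝ | 0 ≤ t ∧ (t : EReal) < horizon τ} := by
  have hs := continuousOn_finsetSum Finset.univ fun j _ => h.state_continuousOn j
  exact (h.state_continuousOn i).sub (hs.const_smul (1 / (N : ℝ)))

theorem IsClosedLoop.lyapunov_continuousOn
    (h : IsClosedLoop G A B K Γ κ ϱ δ μ ν x xt c τ) :
    ContinuousOn (lyapunov G P κ α β ν x c) {t : ℝ | 0 ≤ t ∧ (t : EReal) < horizon τ} := by
  unfold lyapunov
  refine ContinuousOn.add (ContinuousOn.add ?_ ?_) ?_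
  · exact continuousOn_finsetSum _ fun i _ =>
      (continuous_quadForm P).comp_continuousOn (h.consensusError_continuousOn i)
  · exact continuousOn_const.mul (continuousOn_finsetSum _ fun i _ =>
      continuousOn_finsetSum _ fun j _ =>
        continuousOn_const.mul (((h.weight_continuousOn i j).sub continuousOn_const).pow 2))
  · exact Continuous.continuousOn (by fun_prop)

theorem IsClosedLoop.lyapunov_deriv (h : IsClosedLoop G A B K Γ κ ϱ δ μ ν x xt c τ)
    (hP : P.IsHermitian) (hϱ : ∀ i j, G.Adj i j → ϱ i j = 0) (hκ : ∀ i j, G.Adj i j → 0 < κ i j)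
    {t : ℝ} (ht0 : 0 ≤ t) (ht : (t : EReal) < horizon τ)
    (hc : ∀ i j, G.Adj i j → c t i j = c t j i) :
    HasDerivWithinAt (lyapunov G P κ α β ν x c)
      (∑ i, 2 * (consensusError x t i ⬝ᵥ (P *ᵥ (A *ᵥ consensusError x t i
          + B *ᵥ controlInput G K (c t) (xt t) i)))
        + 1 / 2 * ∑ i, ∑ j, G.adjMatrix ℝ i j * (c t i j - α) * quadForm Γ (xt t i - xt t j)
        - β * ν * Real.exp (-ν * t)) (Set.Ici t) t := by
  have h1 : HasDerivWithinAt (fun s => ∑ i, quadForm P (consensusError x s i))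
      (∑ i, 2 * (consensusError x t i ⬝ᵥ (P *ᵥ (A *ᵥ consensusError x t i
          + B *ᵥ controlInput G K (c t) (xt t) i)))) (Set.Ici t) t :=
    HasDerivWithinAt.fun_sum fun i _ =>
      quadForm_hasDerivWithinAt hP (h.consensusError_deriv ht0 ht hc i)
  have h2 : HasDerivWithinAt
      (fun s => 1 / 4 * ∑ i, ∑ j, G.adjMatrix ℝ i j / κ i j * (c s i j - α) ^ 2)
      (1 / 4 * ∑ i, ∑ j, 2 * (G.adjMatrix ℝ i j * (c t i j - α) * quadForm Γ (xt t i - xt t j)))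
      (Set.Ici t) t := by
    refine HasDerivWithinAt.const_mul _ (HasDerivWithinAt.fun_sum fun i _ =>
      HasDerivWithinAt.fun_sum fun j _ => ?_)
    by_cases hij : G.Adj i j
    · have hd := (((h.weight_deriv_of_adj hϱ ht0 ht hij).sub_const α).pow 2).const_mul
        (G.adjMatrix ℝ i j / κ i j)
      refine hd.congr_deriv ?_
      have := (hκ i j hij).ne'
      simp [SimpleGraph.adjMatrix_apply, hij]
      field_simp
    · simp [SimpleGraph.adjMatrix_apply, hij, hasDerivWithinAt_const]
  have h3 : HasDerivWithinAt (fun s => β * Real.exp (-ν * s)) (β * (Real.exp (-ν * t) * (-ν)))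
      (Set.Ici t) t := by
    have : HasDerivAt (fun s => -ν * s) (-ν) t := by simpa using (hasDerivAt_id t).const_mul (-ν)
    exact (this.exp.const_mul β).hasDerivWithinAt
  refine HasDerivWithinAt.congr_deriv (f := lyapunov G P κ α β ν x c) ((h1.add h2).add h3) ?_
  simp only [← Finset.mul_sum]
  ring

theorem lyapunov_nonneg (hP : ∀ v, 0 ≤ quadForm P v) (hκ : ∀ i j, G.Adj i j → 0 < κ i j)
    (hβ : 0 ≤ β) (t : ℝ) : 0 ≤ lyapunov G P κ α β ν x c t := by
  refine add_nonneg (add_nonneg (Finset.sum_nonneg fun i _ => hP _) (mul_nonneg (by norm_num)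
    (Finset.sum_nonneg fun i _ => Finset.sum_nonneg fun j _ => ?_))) (by positivity)
  by_cases hij : G.Adj i j
  · simp only [SimpleGraph.adjMatrix_apply, hij, if_true]
    have := hκ i j hij
    positivity
  · simp [SimpleGraph.adjMatrix_apply, hij]

/-- Decay of the Lyapunov function; `η` is a lower bound of the squared consensus error. -/
theorem IsClosedLoop.lyapunov_decay
    (h : IsClosedLoop G A B (-(Bᵀ * P)) (P * B * Bᵀ * P) κ ϱ δ μ ν x xt c τ)
    (hP : P.IsHermitian) (hARE : P * A + Aᵀ * P - P * B * Bᵀ * P + 1 = 0)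
    (hκ : ∀ i j, G.Adj i j → 0 < κ i j) (hκ_symm : ∀ i j, G.Adj i j → κ i j = κ j i)
    (hϱ : ∀ i j, G.Adj i j → ϱ i j = 0) (hδ : 0 < δ) (hν : 0 < ν)
    (hc_symm : ∀ i j, G.Adj i j → c 0 i j = c 0 j i) (hc_nonneg : ∀ i j, G.Adj i j → 0 ≤ c 0 i j)
    (hN : 0 < N) {C : ℝ} (hC0 : 0 ≤ C)
    (hC : ∀ (m : ℕ) (y : Fin N → Fin m → ℝ), ∑ i, y i = 0 →
      ∑ i, y i ⬝ᵥ y i ≤ C * ∑ i, ∑ j, G.adjMatrix ℝ i j * ((y i - y j) ⬝ᵥ (y i - y j)))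
    {s t η : ℝ} (hs0 : 0 ≤ s) (hst : s ≤ t) (ht : (t : EReal) < horizon τ)
    (hη : ∀ r : ℝ, s ≤ r → (r : EReal) < horizon τ →
      η ≤ ∑ i, consensusError x r i ⬝ᵥ consensusError x r i) :
    lyapunov G P κ (8 * C + 1 / δ) ((8 * C + 2 / δ) * (N * μ) / ν) ν x c t
      ≤ lyapunov G P κ (8 * C + 1 / δ) ((8 * C + 2 / δ) * (N * μ) / ν) ν x c s
        - η * (t - s) := by
  have hsymm : ∀ r : ℝ, 0 ≤ r → (r : EReal) < horizon τ → ∀ i j, G.Adj i j → c r i j = c r j i :=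
    fun r hr0 hr => h.weight_symm hϱ hκ_symm hc_symm hr0 hr
  have hnn : ∀ r : ℝ, 0 ≤ r → (r : EReal) < horizon τ → ∀ i j, G.Adj i j → 0 ≤ c r i j :=
    fun r hr0 hr i j hij => (hc_nonneg i j hij).trans
      (h.weight_mono hϱ hκ (quadForm_gain_nonneg hP B) hij le_rfl hr0 hr)
  have key := sub_le_sub_of_right_deriv (g := fun r => -η * r) (g' := fun _ => -η)
    (h.lyapunov_continuousOn (P := P) (α := 8 * C + 1 / δ) (β := (8 * C + 2 / δ) * (N * μ) / ν))
    (fun r hr0 hr => h.lyapunov_deriv hP hϱ hκ hr0 hr (hsymm r hr0 hr))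
    (Continuous.continuousOn (by fun_prop))
    (fun r _ _ => by simpa using ((hasDerivAt_id r).const_mul (-η)).hasDerivWithinAt)
    (fun r hsr hr => by
      have hr0 := hs0.trans hsr
      have hd := dissipation hP hARE hN hC0 hC (hsymm r hr0 hr) (hnn r hr0 hr) hδ x r (xt r)
        (m := μ * Real.exp (-ν * r)) (fun i => by
          have := h.triggerFn_nonpos hr0 hr i
          rw [triggerFn] at this
          linarith)
      have hη' := hη r hsr hr
      have e : (8 * C + 2 / δ) * (N * μ) / ν * ν * Real.exp (-ν * r)
          = (8 * C + 2 / δ) * (N * (μ * Real.exp (-ν * r))) := by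
        field_simp
      rw [e]
      linarith) hs0 hst ht
  linarith

end Lyapunov

/-! ### Exclusion of accumulating events -/

section Transport

open scoped Matrix.Norms.Operator

/-- Variation of constants: transporting a solution of `f' = A f + b` back along the free motion
leaves only the input. -/
theorem exp_neg_mulVec_hasDerivWithinAt {n : ℕ} (A : Matrix (Fin n) (Fin n) ℝ)
    {f : ℝ → Fin n → ℝ} {b : Fin n → ℝ} {s : Set ℝ} {t : ℝ}
    (hf : HasDerivWithinAt f (A *ᵥ f t + b) s t) :
    HasDerivWithinAt (fun r => NormedSpace.exp ((-r) • A) *ᵥ f r)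
      (NormedSpace.exp ((-t) • A) *ᵥ b) s t := by
  have hM : HasDerivAt (fun r : ℝ => NormedSpace.exp ((-r) • A))
      (-(NormedSpace.exp ((-t) • A) * A)) t := by
    have := (hasDerivAt_exp_smul_const (𝕂 := ℝ) A (-t)).scomp t (hasDerivAt_neg t)
    exact this.congr_deriv (neg_one_smul ℝ _)
  have hentry : ∀ i j, HasDerivAt (fun r : ℝ => NormedSpace.exp ((-r) • A) i j)
      ((-(NormedSpace.exp ((-t) • A) * A)) i j) t := fun i j =>
    (LinearMap.toContinuousLinearMap (Matrix.entryLinearMap ℝ ℝ i j)).hasFDerivAt.comp_hasDerivAt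
      t hM
  refine hasDerivWithinAt_pi.2 fun i => ?_
  have key : HasDerivWithinAt (fun r => ∑ j, NormedSpace.exp ((-r) • A) i j * f r j)
      (∑ j, ((-(NormedSpace.exp ((-t) • A) * A)) i j * f t j
        + NormedSpace.exp ((-t) • A) i j * (A *ᵥ f t + b) j)) s t :=
    HasDerivWithinAt.fun_sum fun j _ =>
      (hentry i j).hasDerivWithinAt.mul (hasDerivWithinAt_pi.1 hf j)
  refine HasDerivWithinAt.congr_deriv
    (f := fun r => (NormedSpace.exp ((-r) • A) *ᵥ f r) i) key ?_
  rw [Finset.sum_add_distrib]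
  change ((-(NormedSpace.exp ((-t) • A) * A)) *ᵥ f t) i
    + (NormedSpace.exp ((-t) • A) *ᵥ (A *ᵥ f t + b)) i = _
  rw [Matrix.neg_mulVec, Matrix.mulVec_add, Matrix.mulVec_mulVec]
  simp

theorem continuous_exp_smul {n : ℕ} (A : Matrix (Fin n) (Fin n) ℝ) :
    Continuous fun r : ℝ => NormedSpace.exp (r • A) :=
  (NormedSpace.exp_continuous (𝔸 := Matrix (Fin n) (Fin n) ℝ)).comp (by fun_prop)

theorem exp_add_smul {n : ℕ} (A : Matrix (Fin n) (Fin n) ℝ) (s t : ℝ) :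
    NormedSpace.exp ((s + t) • A) = NormedSpace.exp (s • A) * NormedSpace.exp (t • A) := by
  rw [add_smul, Matrix.exp_add_of_commute]
  exact ((Commute.refl A).smul_left s).smul_right t

variable {N n p : ℕ} {G : SimpleGraph (Fin N)} [DecidableRel G.Adj]
  {A P : Matrix (Fin n) (Fin n) ℝ} {B : Matrix (Fin n) (Fin p) ℝ}
  {κ ϱ : Fin N → Fin N → ℝ} {δ μ ν : ℝ}
  {x xt : ℝ → Fin N → Fin n → ℝ} {c : ℝ → Fin N → Fin N → ℝ} {τ : Fin N → ℕ → EReal}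

theorem norm_controlInput_le (hP : P.IsHermitian) {Cb : ℝ} {c : Fin N → Fin N → ℝ}
    (hc : ∀ i j, G.Adj i j → |c i j| ≤ Cb) (z : Fin N → Fin n → ℝ) (i : Fin N) :
    ‖controlInput G (-(Bᵀ * P)) c z i‖
      ≤ Cb * ∑ j, G.adjMatrix ℝ i j * (1 + quadForm (P * B * Bᵀ * P) (z i - z j)) := by
  rw [controlInput, Matrix.mulVec_sum, Finset.mul_sum]
  refine (norm_sum_le _ _).trans (Finset.sum_le_sum fun j _ => ?_)
  by_cases hij : G.Adj i j
  · rw [Matrix.mulVec_smul, norm_smul, Matrix.neg_mulVec, norm_neg, quadForm_eq_normSq P hP]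
    simp only [SimpleGraph.adjMatrix_apply, hij, if_true, mul_one, one_mul, Real.norm_eq_abs]
    exact mul_le_mul (hc i j hij) (norm_le_one_add_dotProduct_self _) (norm_nonneg _)
      ((abs_nonneg _).trans (hc i j hij))
  · simp [SimpleGraph.adjMatrix_apply, hij]

/-- If the weights stay bounded, then the events of no agent accumulate at a finite time. The speed
of the transported state `e^{-tA} xᵢ(t)` is bounded by the derivative of a function of `t` and the
weights `cᵢⱼ(t)`. That function is bounded and monotone, so the transported state oscillates
arbitrarily little before the accumulation time; but every event needs a fixed oscillation. -/
theorem IsClosedLoop.horizon_eq_top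
    (h : IsClosedLoop G A B (-(Bᵀ * P)) (P * B * Bᵀ * P) κ ϱ δ μ ν x xt c τ)
    (hP : P.IsHermitian) (hκ : ∀ i j, G.Adj i j → 0 < κ i j)
    (hϱ : ∀ i j, G.Adj i j → ϱ i j = 0) (hδ : 0 < δ) (hμ : 0 < μ) (hν : 0 < ν) (hN : 0 < N)
    {Cb : ℝ} (hCb : 0 ≤ Cb)
    (hc : ∀ t : ℝ, 0 ≤ t → (t : EReal) < horizon τ → ∀ i j, G.Adj i j → |c t i j| ≤ Cb) :
    horizon τ = ⊤ := by
  by_contra htop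
  have : Nonempty (Fin N) := ⟨⟨0, hN⟩⟩
  obtain ⟨i, hi⟩ : ∃ i, ⨆ k, τ i k = horizon τ := exists_eq_ciInf_of_finite
  have hT0 : 0 ≤ horizon τ := by
    rw [← hi, ← h.event_zero i]; exact le_iSup (τ i) 0
  have hbot : horizon τ ≠ ⊥ := fun hb => by simp [hb] at hT0
  obtain ⟨T, hT⟩ : ∃ T : ℝ, (T : EReal) = horizon τ := ⟨_, EReal.coe_toReal htop hbot⟩
  have hlt : ∀ {t : ℝ}, (t : EReal) < horizon τ → t < T := fun {t} ht => by
    rw [← hT] at ht; exact EReal.coe_lt_coe_iff.1 ht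
  obtain ⟨K₁, hK₁⟩ := (isCompact_Icc (a := (0 : ℝ)) (b := T)).exists_bound_of_continuousOn
    (f := fun r : ℝ => NormedSpace.exp ((-r) • A))
    ((continuous_exp_smul A).comp continuous_neg).continuousOn
  obtain ⟨K₂, hK₂⟩ := (isCompact_Icc (a := (0 : ℝ)) (b := T)).exists_bound_of_continuousOn
    (continuous_exp_smul A).continuousOn
  set Γ := P * B * Bᵀ * P with hΓ
  set M := K₁ * ‖B‖ * Cb with hM
  -- the transported state, and the function whose increments bound its oscillation
  set y : ℝ → Fin n → ℝ := fun r => NormedSpace.exp ((-r) • A) *ᵥ x r i with hy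
  set S : ℝ → ℝ := fun r => M * ∑ j, G.adjMatrix ℝ i j * (r + c r i j / κ i j) with hS
  have hycont : ContinuousOn y {t : ℝ | 0 ≤ t ∧ (t : EReal) < horizon τ} := by
    have hE : Continuous fun r : ℝ => NormedSpace.exp ((-r) • A) :=
      (continuous_exp_smul A).comp continuous_neg
    intro t ht
    exact Filter.Tendsto.comp (g := fun q : Matrix (Fin n) (Fin n) ℝ × (Fin n → ℝ) => q.1 *ᵥ q.2)
      ((Continuous.matrix_mulVec continuous_fst continuous_snd).tendsto _)
      ((hE.continuousWithinAt (x := t)).prodMk_nhds (h.state_continuousOn i t ht))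
  have hScont : ContinuousOn S {t : ℝ | 0 ≤ t ∧ (t : EReal) < horizon τ} :=
    continuousOn_const.mul (continuousOn_finsetSum _ fun j _ =>
      continuousOn_const.mul (continuousOn_id.add ((h.weight_continuousOn i j).div_const _)))
  have hSderiv : ∀ t : ℝ, 0 ≤ t → (t : EReal) < horizon τ → HasDerivWithinAt S
      (M * ∑ j, G.adjMatrix ℝ i j * (1 + quadForm Γ (xt t i - xt t j))) (Set.Ici t) t := by
    intro t ht0 ht
    refine HasDerivWithinAt.const_mul _ (HasDerivWithinAt.fun_sum fun j _ => ?_)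
    by_cases hij : G.Adj i j
    · refine HasDerivWithinAt.const_mul _ ((hasDerivWithinAt_id t _).add
        (((h.weight_deriv_of_adj hϱ ht0 ht hij).div_const (κ i j)).congr_deriv ?_))
      have := (hκ i j hij).ne'
      field_simp
    · simp [SimpleGraph.adjMatrix_apply, hij, hasDerivWithinAt_const]
  have hosc : ∀ {s t : ℝ}, 0 ≤ s → s ≤ t → (t : EReal) < horizon τ → ‖y t - y s‖ ≤ S t - S s :=
    fun {s t} hs0 hst ht => norm_sub_le_sub_of_right_deriv hycont
      (fun r hr0 hr => exp_neg_mulVec_hasDerivWithinAt A (h.state_deriv r hr0 hr i)) hScont hSderiv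
      (fun r hr0 hr => by
        have hK := hK₁ r ⟨hr0, (hlt hr).le⟩
        have hu := norm_controlInput_le (B := B) hP (hc r hr0 hr) (xt r) i
        calc ‖NormedSpace.exp ((-r) • A) *ᵥ (B *ᵥ controlInput G (-(Bᵀ * P)) (c r) (xt r) i)‖
            ≤ K₁ * (‖B‖ * ‖controlInput G (-(Bᵀ * P)) (c r) (xt r) i‖) :=
              (Matrix.linfty_opNorm_mulVec _ _).trans (mul_le_mul hK
                (Matrix.linfty_opNorm_mulVec _ _) (norm_nonneg _) ((norm_nonneg _).trans hK))
          _ ≤ K₁ * (‖B‖ * (Cb * ∑ j, G.adjMatrix ℝ i j * (1 + quadForm Γ (xt r i - xt r j)))) :=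
              mul_le_mul_of_nonneg_left (mul_le_mul_of_nonneg_left hu (norm_nonneg _))
                ((norm_nonneg _).trans hK)
          _ = M * ∑ j, G.adjMatrix ℝ i j * (1 + quadForm Γ (xt r i - xt r j)) := by
              rw [hM]; ring) hs0 hst ht
  -- after any time there is an event `r`, followed by an `s` at which the next event is due
  have hnext : ∀ t : ℝ, (t : EReal) < horizon τ → ∃ k, ∃ r s : ℝ, τ i k = r ∧ 0 ≤ r ∧ t < r ∧
      r < s ∧ (s : EReal) < horizon τ ∧ ∃ z : Fin N → Fin n → ℝ,
        0 ≤ triggerFn G Γ δ μ ν (c s) i (x s i) (estimate A τ x i k s) z s := by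
    intro t ht
    rw [← hi] at ht
    obtain ⟨k, hk⟩ := lt_iSup_iff.1 ht
    obtain ⟨z, -, hz⟩ := h.event_succ i k
    have hne : τ i (k + 1) < ⊤ :=
      lt_of_le_of_lt (hi ▸ le_iSup (τ i) (k + 1)) (lt_top_iff_ne_top.2 htop)
    rw [hz] at hne
    obtain ⟨_, ⟨s, ⟨hks, hsT, htr⟩, rfl⟩, -⟩ := sInf_lt_iff.1 hne
    have hr : ((τ i k).toReal : EReal) = τ i k :=
      EReal.coe_toReal (ne_top_of_lt hks) (ne_bot_of_gt hk)
    have hr0 := h.event_nonneg i k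
    refine ⟨k, (τ i k).toReal, s, hr.symm, ?_, ?_, ?_, hsT, z s, htr⟩
    · rw [← hr] at hr0; exact EReal.coe_nonneg.1 hr0
    · rw [← hr] at hk; exact EReal.coe_lt_coe_iff.1 hk
    · rw [← hr] at hks; exact EReal.coe_lt_coe_iff.1 hks
  have hT0' : (0 : ℝ) ≤ T := by rw [← hT] at hT0; exact EReal.coe_nonneg.1 hT0
  have hTpos : ((0 : ℝ) : EReal) < horizon τ := by
    rcases eq_or_lt_of_le hT0 with h0 | h0
    · -- a zero horizon leaves no room for the first event
      exfalso
      obtain ⟨k, r, s, -, hr0, -, hrs, hsT, -⟩ := hnext (-1) (by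
        rw [← h0]; exact EReal.coe_neg'.2 (by norm_num))
      rw [← h0] at hsT
      have := EReal.coe_neg'.1 hsT
      linarith
    · exact h0
  set D := {t : ℝ | 0 ≤ t ∧ (t : EReal) < horizon τ} with hD
  have hM0 : 0 ≤ M := mul_nonneg (mul_nonneg ((norm_nonneg _).trans (hK₁ 0 ⟨le_rfl, hT0'⟩))
    (norm_nonneg _)) hCb
  have hbdd : BddAbove (S '' D) := by
    refine ⟨M * ∑ j, G.adjMatrix ℝ i j * (T + Cb / κ i j), ?_⟩
    rintro _ ⟨t, ht, rfl⟩
    refine mul_le_mul_of_nonneg_left (Finset.sum_le_sum fun j _ => ?_) hM0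
    by_cases hij : G.Adj i j
    · refine mul_le_mul_of_nonneg_left (add_le_add (hlt ht.2).le ?_) (adjMatrix_nonneg G i j)
      have := hκ i j hij
      gcongr
      exact (le_abs_self _).trans (hc t ht.1 ht.2 i j hij)
    · simp [SimpleGraph.adjMatrix_apply, hij]
  set K₃ := (N : ℝ) * (1 + δ * Cb) * (p * ‖Bᵀ * P‖ ^ 2) * K₂ ^ 2 with hK₃
  have hK₃0 : 0 ≤ K₃ := by positivity
  set m := μ * Real.exp (-ν * T) with hm
  have hm0 : 0 < m := by positivity
  -- an oscillation of size `ε` is too small to reach the threshold, which is at least `m`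
  set ε := √(m / (K₃ + 1)) with hε
  have hε0 : 0 < ε := Real.sqrt_pos.2 (by positivity)
  have hεm : K₃ * ε ^ 2 < m := by
    rw [hε, Real.sq_sqrt (by positivity), mul_div_assoc', div_lt_iff₀ (by positivity)]
    nlinarith
  obtain ⟨_, ⟨t, ht, rfl⟩, htS⟩ := exists_lt_of_lt_csSup (s := S '' D) ⟨_, 0, ⟨le_rfl, hTpos⟩, rfl⟩
    (sub_lt_self (sSup (S '' D)) hε0)
  obtain ⟨k, r, s, hkr, hr0, htr, hrs, hsT, z, hz⟩ := hnext t ht.2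
  have hrT : (r : EReal) < horizon τ := (EReal.coe_lt_coe_iff.2 hrs).trans hsT
  have hs0 := hr0.trans hrs.le
  have hSr : S t ≤ S r := by
    have := (norm_nonneg _).trans (hosc ht.1 htr.le hrT); linarith
  have hSs : S s ≤ sSup (S '' D) := le_csSup hbdd ⟨s, ⟨hs0, hsT⟩, rfl⟩
  have hys : ‖y r - y s‖ ≤ ε := by
    rw [norm_sub_rev]
    refine (hosc hr0 hrs.le hsT).trans ?_
    linarith
  have herr : estimate A τ x i k s - x s i = NormedSpace.exp (s • A) *ᵥ (y r - y s) := by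
    have e1 : NormedSpace.exp (s • A) * NormedSpace.exp ((-r) • A)
        = NormedSpace.exp ((s - r) • A) := by rw [← exp_add_smul, sub_eq_add_neg]
    have e2 : NormedSpace.exp (s • A) * NormedSpace.exp ((-s) • A) = 1 := by
      rw [← exp_add_smul, add_neg_cancel, zero_smul, NormedSpace.exp_zero]
    rw [estimate, hkr, EReal.toReal_coe, hy]
    simp only
    rw [Matrix.mulVec_sub, Matrix.mulVec_mulVec, Matrix.mulVec_mulVec, e1, e2, Matrix.one_mulVec]
  have hK₂0 : 0 ≤ K₂ := (norm_nonneg _).trans (hK₂ 0 ⟨le_rfl, hT0'⟩)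
  have henorm : ‖estimate A τ x i k s - x s i‖ ≤ K₂ * ε := by
    rw [herr]
    exact (Matrix.linfty_opNorm_mulVec _ _).trans
      (mul_le_mul (hK₂ s ⟨hs0, (hlt hsT).le⟩) hys (norm_nonneg _) hK₂0)
  have hquad : quadForm Γ (estimate A τ x i k s - x s i) ≤ p * ‖Bᵀ * P‖ ^ 2 * (K₂ * ε) ^ 2 := by
    rw [hΓ, quadForm_eq_normSq P hP]
    refine (dotProduct_self_le_norm _).trans ?_
    rw [mul_assoc, ← mul_pow]
    have h1 : ‖(Bᵀ * P) *ᵥ (estimate A τ x i k s - x s i)‖ ≤ ‖Bᵀ * P‖ * (K₂ * ε) :=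
      (Matrix.linfty_opNorm_mulVec _ _).trans (mul_le_mul_of_nonneg_left henorm (norm_nonneg _))
    gcongr
  have hq0 : 0 ≤ quadForm Γ (estimate A τ x i k s - x s i) := quadForm_gain_nonneg hP B _
  have hsum : ∑ j, (1 + δ * c s i j) * G.adjMatrix ℝ i j *
      quadForm Γ (estimate A τ x i k s - x s i)
      ≤ ∑ _j : Fin N, (1 + δ * Cb) * (p * ‖Bᵀ * P‖ ^ 2 * (K₂ * ε) ^ 2) := by
    refine Finset.sum_le_sum fun j _ => ?_
    by_cases hij : G.Adj i j
    · have hcj := (le_abs_self _).trans (hc s hs0 hsT i j hij)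
      simp only [SimpleGraph.adjMatrix_apply, hij, if_true, mul_one]
      refine mul_le_mul ?_ hquad hq0 (by positivity)
      gcongr
    · simp only [SimpleGraph.adjMatrix_apply, hij, if_false, mul_zero, zero_mul]
      positivity
  have hdisagree : 0 ≤ ∑ j, G.adjMatrix ℝ i j * quadForm Γ (estimate A τ x i k s - z j) :=
    Finset.sum_nonneg fun j _ => mul_nonneg (adjMatrix_nonneg G i j) (quadForm_gain_nonneg hP B _)
  have hexp : m ≤ μ * Real.exp (-ν * s) := by
    rw [hm]
    have := hlt hsT
    refine mul_le_mul_of_nonneg_left (Real.exp_le_exp.2 ?_) hμ.le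
    nlinarith
  rw [triggerFn] at hz
  rw [Finset.sum_const, Finset.card_univ, Fintype.card_fin, nsmul_eq_mul] at hsum
  have : (N : ℝ) * ((1 + δ * Cb) * (p * ‖Bᵀ * P‖ ^ 2 * (K₂ * ε) ^ 2)) = K₃ * ε ^ 2 := by
    rw [hK₃]; ring
  linarith

end Transport

/-! ### Consensus -/

theorem exists_tendsto_of_monotone_of_le {f : ℝ → ℝ} {b : ℝ}
    (hf : ∀ s t, 0 ≤ s → s ≤ t → f s ≤ f t) (hb : ∀ t, 0 ≤ t → f t ≤ b) :
    ∃ l, Tendsto f atTop (𝓝 l) := by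
  have hmono : Monotone fun t => f (max 0 t) := fun s t hst =>
    hf _ _ (le_max_left 0 s) (max_le_max le_rfl hst)
  have hbdd : BddAbove (Set.range fun t => f (max 0 t)) := by
    refine ⟨b, ?_⟩
    rintro _ ⟨t, rfl⟩
    exact hb _ (le_max_left 0 t)
  refine ⟨_, (tendsto_atTop_ciSup hmono hbdd).congr' ?_⟩
  filter_upwards [eventually_ge_atTop 0] with t ht
  rw [max_eq_right ht]

theorem abs_le_of_lyapunov_le {N n : ℕ} {G : SimpleGraph (Fin N)} [DecidableRel G.Adj]
    {P : Matrix (Fin n) (Fin n) ℝ} {κ : Fin N → Fin N → ℝ} {α β ν : ℝ}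
    {x : ℝ → Fin N → Fin n → ℝ} {c : ℝ → Fin N → Fin N → ℝ}
    (hP : ∀ v, 0 ≤ quadForm P v) (hκ : ∀ i j, G.Adj i j → 0 < κ i j) (hβ : 0 ≤ β) {t U : ℝ}
    (hU : lyapunov G P κ α β ν x c t ≤ U) {i j : Fin N} (hij : G.Adj i j) :
    |c t i j| ≤ |α| + 1 + 4 * κ i j * U := by
  have hterm : ∀ i j, 0 ≤ G.adjMatrix ℝ i j / κ i j * (c t i j - α) ^ 2 := by
    intro i j
    by_cases hij : G.Adj i j
    · simp only [SimpleGraph.adjMatrix_apply, hij, if_true]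
      have := hκ i j hij
      positivity
    · simp [SimpleGraph.adjMatrix_apply, hij]
  have h1 : G.adjMatrix ℝ i j / κ i j * (c t i j - α) ^ 2
      ≤ ∑ i, ∑ j, G.adjMatrix ℝ i j / κ i j * (c t i j - α) ^ 2 :=
    (Finset.single_le_sum (f := fun j => G.adjMatrix ℝ i j / κ i j * (c t i j - α) ^ 2)
      (fun j _ => hterm i j) (Finset.mem_univ j)).trans
    (Finset.single_le_sum (f := fun i => ∑ j, G.adjMatrix ℝ i j / κ i j * (c t i j - α) ^ 2)
      (fun i _ => Finset.sum_nonneg fun j _ => hterm i j) (Finset.mem_univ i))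
  have h2 : 0 ≤ ∑ i, quadForm P (consensusError x t i) := Finset.sum_nonneg fun i _ => hP _
  have h3 : 0 ≤ β * Real.exp (-ν * t) := by positivity
  have hk := hκ i j hij
  have h4 : (c t i j - α) ^ 2 ≤ 4 * κ i j * U := by
    rw [lyapunov] at hU
    simp only [SimpleGraph.adjMatrix_apply, hij, if_true] at h1
    have h5 : 1 / κ i j * (c t i j - α) ^ 2 ≤ 4 * U := by
      simp only [SimpleGraph.adjMatrix_apply] at hU h1
      linarith
    rw [one_div_mul_eq_div, div_le_iff₀ hk] at h5
    linarith
  have h6 : |c t i j - α| ≤ 1 + (c t i j - α) ^ 2 := by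
    rw [abs_le]
    constructor <;> nlinarith [sq_nonneg (c t i j - α - 1), sq_nonneg (c t i j - α + 1)]
  have h7 : |c t i j| ≤ |c t i j - α| + |α| := by
    simpa using abs_add_le (c t i j - α) α
  linarith

section Consensus

variable {N n p : ℕ} {G : SimpleGraph (Fin N)} [DecidableRel G.Adj]
  {A P : Matrix (Fin n) (Fin n) ℝ} {B : Matrix (Fin n) (Fin p) ℝ}
  {κ ϱ : Fin N → Fin N → ℝ} {δ μ ν : ℝ}
  {x xt : ℝ → Fin N → Fin n → ℝ} {c : ℝ → Fin N → Fin N → ℝ} {τ : Fin N → ℕ → EReal}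

/-- If the Lyapunov function decays at the rate of the squared consensus error and the (monotone)
weights are bounded, then the consensus error vanishes asymptotically. The Lyapunov function and
the weights converge, hence so does `∑ ξᵢᵀ P ξᵢ`; a positive limit would make the Lyapunov function
negative eventually. -/
theorem tendsto_consensusError {α β Cb : ℝ} (hP : P.PosDef)
    (hκ : ∀ i j, G.Adj i j → 0 < κ i j) (hβ : 0 ≤ β) (hν : 0 < ν)
    (hdecay : ∀ s t η : ℝ, 0 ≤ s → s ≤ t →
      (∀ r, s ≤ r → η ≤ ∑ i, consensusError x r i ⬝ᵥ consensusError x r i) →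
      lyapunov G P κ α β ν x c t ≤ lyapunov G P κ α β ν x c s - η * (t - s))
    (hmono : ∀ i j, G.Adj i j → ∀ s t, 0 ≤ s → s ≤ t → c s i j ≤ c t i j)
    (hbound : ∀ i j, G.Adj i j → ∀ t, 0 ≤ t → c t i j ≤ Cb) :
    Tendsto (consensusError x) atTop (𝓝 0) := by
  obtain ⟨k, hk, hPk⟩ := PosDef.exists_le_quadForm hP
  obtain ⟨K, hK, hPK⟩ := quadForm_le P
  have hP0 : ∀ v, 0 ≤ quadForm P v := fun v => le_trans (by positivity) (hPk v)
  have hU0 : ∀ t, 0 ≤ lyapunov G P κ α β ν x c t := lyapunov_nonneg hP0 hκ hβ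
  set V : ℝ → ℝ := fun t => ∑ i, quadForm P (consensusError x t i) with hV
  have hV0 : ∀ t, 0 ≤ V t := fun t => Finset.sum_nonneg fun i _ => hP0 _
  obtain ⟨l₁, hl₁⟩ : ∃ l, Tendsto (fun t => -lyapunov G P κ α β ν x c t) atTop (𝓝 l) := by
    refine exists_tendsto_of_monotone_of_le (b := 0) (fun s t hs hst => ?_) fun t _ => ?_
    · have := hdecay s t 0 hs hst fun r _ =>
        Finset.sum_nonneg fun i _ => zero_le_dotProduct_self _
      linarith
    · linarith [hU0 t]
  have hw : ∀ i j, ∃ l, Tendsto (fun t => G.adjMatrix ℝ i j / κ i j * (c t i j - α) ^ 2)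
      atTop (𝓝 l) := by
    intro i j
    by_cases hij : G.Adj i j
    · obtain ⟨l, hl⟩ := exists_tendsto_of_monotone_of_le (hmono i j hij) (hbound i j hij)
      exact ⟨_, ((hl.sub_const α).pow 2).const_mul _⟩
    · exact ⟨0, by simp [SimpleGraph.adjMatrix_apply, hij]⟩
  choose l₂ hl₂ using hw
  have hexp : Tendsto (fun t : ℝ => β * Real.exp (-ν * t)) atTop (𝓝 (β * 0)) :=
    (Real.tendsto_exp_atBot.comp
      (tendsto_id.const_mul_atTop_of_neg (neg_lt_zero.2 hν))).const_mul β
  obtain ⟨l, hl⟩ : ∃ l, Tendsto V atTop (𝓝 l) := by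
    have h := (hl₁.neg.sub ((tendsto_finsetSum Finset.univ fun i _ =>
      tendsto_finsetSum Finset.univ fun j _ => hl₂ i j).const_mul (1 / 4))).sub hexp
    refine ⟨_, h.congr fun t => ?_⟩
    simp only [lyapunov, hV]
    ring
  have hl0 : l = 0 := by
    refine le_antisymm (not_lt.1 fun hlpos => ?_) (ge_of_tendsto' hl hV0)
    obtain ⟨t₀, ht₀⟩ := eventually_atTop.1 (hl.eventually (lt_mem_nhds (half_lt_self hlpos)))
    -- decay at the constant rate `η` makes the Lyapunov function negative in finite time
    set s := max 0 t₀ with hs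
    set η := l / 2 / K with hη
    have hηpos : 0 < η := by positivity
    have hlow : ∀ r, s ≤ r → η ≤ ∑ i, consensusError x r i ⬝ᵥ consensusError x r i := by
      intro r hr
      rw [hη, div_le_iff₀ hK, mul_comm, Finset.mul_sum]
      exact (ht₀ r ((le_max_right _ _).trans hr)).le.trans (Finset.sum_le_sum fun i _ => hPK _)
    set U := lyapunov G P κ α β ν x c s with hU
    have hUs : 0 ≤ U := hU0 s
    have h := hdecay s (s + (U / η + 1)) η (le_max_left _ _)
      (by have : 0 ≤ U / η := by positivity
          linarith) hlow
    have e : η * (s + (U / η + 1) - s) = U + η := by field_simp; ring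
    rw [e] at h
    linarith [hU0 (s + (U / η + 1))]
  rw [hl0] at hl
  refine tendsto_pi_nhds.2 fun i => ?_
  have hsq : Tendsto (fun t => ‖consensusError x t i‖ ^ 2) atTop (𝓝 0) := by
    refine squeeze_zero (g := fun t => V t / k) (fun t => by positivity) (fun t => ?_)
      (by simpa using hl.div_const k)
    rw [le_div_iff₀ hk, mul_comm]
    exact (hPk _).trans (Finset.single_le_sum
      (f := fun i => quadForm P (consensusError x t i)) (fun i _ => hP0 _) (Finset.mem_univ i))
  have hnorm := hsq.sqrt
  simp only [Real.sqrt_sq (norm_nonneg _), Real.sqrt_zero] at hnorm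
  exact tendsto_zero_iff_norm_tendsto_zero.2 hnorm

end Consensus

end EventConsensus

theorem corollary1 {N n p q : ℕ}
    (A : Matrix (Fin n) (Fin n) ℝ) (B : Matrix (Fin n) (Fin p) ℝ) (C : Matrix (Fin q) (Fin n) ℝ)
    (hAB : EventConsensus.Stabilizable A B) (hAC : EventConsensus.Detectable A C)
    (G : SimpleGraph (Fin N)) [DecidableRel G.Adj] (hG : G.Connected)
    (P : Matrix (Fin n) (Fin n) ℝ) (hP : P.PosDef)
    (hARE : P * A + Aᵀ * P - P * B * Bᵀ * P + 1 = 0)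
    (κ ϱ : Fin N → Fin N → ℝ)
    (hκ : ∀ i j, G.Adj i j → 0 < κ i j) (hκ_symm : ∀ i j, G.Adj i j → κ i j = κ j i)
    (hϱ : ∀ i j, G.Adj i j → ϱ i j = 0)
    (δ μ ν : ℝ) (hδ : 0 < δ) (hμ : 0 < μ) (hν : 0 < ν)
    (x xt : ℝ → Fin N → Fin n → ℝ) (c : ℝ → Fin N → Fin N → ℝ) (τ : Fin N → ℕ → EReal)
    (hcl : EventConsensus.IsClosedLoop G A B (-(Bᵀ * P)) (P * B * Bᵀ * P) κ ϱ δ μ ν x xt c τ)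
    (hc_symm : ∀ i j, G.Adj i j → c 0 i j = c 0 j i)
    (hc_nonneg : ∀ i j, G.Adj i j → 0 ≤ c 0 i j) :
    EventConsensus.horizon τ = ⊤ ∧
      Filter.Tendsto (EventConsensus.consensusError x) Filter.atTop (nhds 0) := by
  have hN : 0 < N := by
    obtain ⟨i⟩ := hG.nonempty
    exact i.pos
  have hP0 : ∀ v, 0 ≤ EventConsensus.quadForm P v := fun v => by
    simpa [EventConsensus.quadForm] using hP.posSemidef.dotProduct_mulVec_nonneg v
  obtain ⟨R, hR0, hR⟩ := EventConsensus.exists_poincare G hG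
  have hβ : 0 ≤ (8 * R + 2 / δ) * (N * μ) / ν := by positivity
  have hdecay := fun (s t η : ℝ) => hcl.lyapunov_decay hP.isHermitian hARE hκ hκ_symm hϱ hδ hν
    hc_symm hc_nonneg hN hR0 hR (s := s) (t := t) (η := η)
  set U := EventConsensus.lyapunov G P κ (8 * R + 1 / δ) ((8 * R + 2 / δ) * (N * μ) / ν) ν x c 0
    with hU
  have hU0 : 0 ≤ U := EventConsensus.lyapunov_nonneg hP0 hκ hβ 0
  set Cb := ∑ i, ∑ j, (|8 * R + 1 / δ| + 1 + 4 * |κ i j| * U) with hCb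
  have hCb0 : 0 ≤ Cb := Finset.sum_nonneg fun i _ => Finset.sum_nonneg fun j _ => by positivity
  have hbound : ∀ t : ℝ, 0 ≤ t → (t : EReal) < EventConsensus.horizon τ →
      ∀ i j, G.Adj i j → |c t i j| ≤ Cb := by
    intro t ht0 ht i j hij
    have hle := hdecay 0 t 0 le_rfl ht0 ht fun r _ _ =>
      Finset.sum_nonneg fun i _ => EventConsensus.zero_le_dotProduct_self _
    rw [zero_mul, sub_zero] at hle
    calc |c t i j| ≤ |8 * R + 1 / δ| + 1 + 4 * κ i j * U :=
          EventConsensus.abs_le_of_lyapunov_le hP0 hκ hβ hle hij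
      _ ≤ |8 * R + 1 / δ| + 1 + 4 * |κ i j| * U := by
          gcongr
          exact le_abs_self _
      _ ≤ ∑ j, (|8 * R + 1 / δ| + 1 + 4 * |κ i j| * U) :=
          Finset.single_le_sum (f := fun j => |8 * R + 1 / δ| + 1 + 4 * |κ i j| * U)
            (fun j _ => by positivity) (Finset.mem_univ j)
      _ ≤ Cb := Finset.single_le_sum
            (f := fun i => ∑ j, (|8 * R + 1 / δ| + 1 + 4 * |κ i j| * U))
            (fun i _ => Finset.sum_nonneg fun j _ => by positivity) (Finset.mem_univ i)
  have htop : EventConsensus.horizon τ = ⊤ :=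
    hcl.horizon_eq_top hP.isHermitian hκ hϱ hδ hμ hν hN hCb0 hbound
  have hlt : ∀ t : ℝ, (t : EReal) < EventConsensus.horizon τ := fun t => by
    rw [htop]; exact EReal.coe_lt_top t
  exact ⟨htop, EventConsensus.tendsto_consensusError hP hκ hβ hν
    (fun s t η hs hst hη => hdecay s t η hs hst (hlt t) fun r hr _ => hη r hr)
    (fun i j hij s t hs hst => hcl.weight_mono hϱ hκ
      (EventConsensus.quadForm_gain_nonneg hP.isHermitian B) hij hs hst (hlt t))
    (fun i j hij t ht => (le_abs_self _).trans (hbound t ht (hlt t) i j hij))⟩
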